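/- Let $L=\mathcal O(1)\to X=\mathbb P^1$ be the hyperplane line bundle over the Riemann sphere. A (semi-positively curved, locally bounded) metric on $L$ is identified with its weight $\Phi(z)$ in the affine coordinate $z\in\mathbb C$; the Fubini–Study metric is $\Phi_0(z)=\log(1+|z|^2)$, and $\omega_\Phi=\frac{i}{2\pi}\partial\bar\partial\Phi$ denotes the curvature current, $\omega_0=\omega_{\Phi_0}$. Let $\mathcal H_{1,1}$ be the space of metrics on $L$ whose curvature is a semi-positive $(1,1)$-form on $\mathbb P^1$ with $L^\infty$ coefficients, and let $\mathcal M$ be Mabuchi's K-energy, extended to $\mathcal H_{1,1}$ by the Chen–Tian formula $$\mathcal M(\Phi)=\Big(\tfrac{\bar R}{2}\mathcal E(\Phi)-\mathcal E^{\mathrm{Ric}\,\omega_0}(\Phi)\Big)+\int_{\mathbb P^1}\log\Big(\frac{\omega_\Phi}{\omega_0}\Big)\omega_\Phi,\qquad \bar R=\frac{\int \mathrm{Ric}\,\omega_0}{\int\omega_0},$$ where $\mathcal E$ and $\mathcal E^{\mathrm{Ric}\,\omega_0}$ have differentials $2\omega_\Phi$ and $\mathrm{Ric}\,\omega_0=-\frac{i}{2\pi}\partial\bar\partial\log\omega_0$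 and vanish at $\Phi_0$. A curve $(\Phi_t)_{0\le t\le1}$ is a (weak) geodesic if it is the largest bounded curve with semi-positive curvature on $\mathbb P^1\times\{0<\mathrm{Re}\,\tau<1\}$ ($t=\mathrm{Re}\,\tau$), upper semicontinuous up to the boundary, among those lying below $\Phi_0$ and $\Phi_1$ at $t=0$ and $t=1$ (equivalently, the weak solution of the geodesic equation, i.e. of the homogeneous complex Monge–Ampère equation). **Theorem 1.1.** There exists a geodesic $(\Phi_t)_{0\le t\le1}$ in $\mathcal H_{1,1}$ (so $\Phi_t\in\mathcal H_{1,1}$ for all $t$), starting at the Fubini–Study metric $\Phi_0$, with every $\Phi_t$ invariant under the standard $S^1$-action, such that $t\mapsto\mathcal M(\Phi_t)$ is affine on $[0,1]$, but $\Phi_t$ is not of the form $g(t)\Phi_0$ for any (continuous, real) one-parameter subgroup $g$ of $\mathrm{Aut}(\mathbb P^1,\mathcal O(1))=GL_2(\mathbb C)$ acting by pull-back. Moreover it can be taken so that, with $\phi_t(x)=\Phi_t(z)$, $x=\log|z|^2$, the Legendre transform $\phi_t^*(y)=\sup_{x\in\mathbb R}(xy-\phi_t(x))$ is $$\phi_t^*(y)=u_0(y)+t\,v(y)\quad(0\le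 y\le1),\qquad \phi_t^*(y)=+\infty\quad(y\notin[0,1]),$$ where $u_0(y)=y\log y+(1-y)\log(1-y)$ and $v(y)=\max(0,y-\tfrac12)$. Consequently $\mathcal M$ is not strictly convex on $\mathcal H_{1,1}$ modulo automorphisms: it is not true that every geodesic in $\mathcal H_{1,1}$ along which $\mathcal M$ is affine is of the form $g(t)\Phi_0$. -/

import Mathlib

open scoped ContDiff

noncomputable section

namespace KEnergy

/-! ### Metrics on `O(1)` over the Riemann sphere

The fibre of the dual line bundle `O(-1)` over the point `[v] ∈ ℙ¹` is the line `ℂ v ⊆ ℂ²`.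
A (Hermitian) metric on `O(1)` is the same thing as a metric on `O(-1)`, that is, a function
`h : ℂ² → ℝ` (the squared norm) with `h (c v) = |c|² h v` and `h v > 0` for `v ≠ 0`.
The additive notation `Φ` for such a metric means `Φ(z) = log h (1, z)` in the affine coordinate
`z ↦ [1 : z]`, and `log h (w, 1)` in the coordinate `w ↦ [w : 1]`. -/

/-- Squared norm functions on `ℂ²`, i.e. metrics on `O(1)`. The conditions are imposed below. -/
abbrev SqNorm : Type := (Fin 2 → ℂ) → ℝ

/-- The Fubini-Study metric `|v₀|² + |v₁|²`, i.e. `Φ₀(z) = log (1 + |z|²)`. -/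
def fubiniStudy : SqNorm := fun v => ‖v 0‖ ^ 2 + ‖v 1‖ ^ 2

/-- The weight `Φ(z) = log h (1, z)` in the affine coordinate `z`. -/
def weight (h : SqNorm) (z : ℂ) : ℝ := Real.log (h ![1, z])

/-- The weight `log h (w, 1)` in the affine coordinate `w = 1 / z` at infinity. -/
def weightAtInfinity (h : SqNorm) (w : ℂ) : ℝ := Real.log (h ![w, 1])

/-- `ρ` is the density, with respect to the Lebesgue measure `dA` of `ℂ`, of the current
`(i / 2π) ∂∂̄ φ = (1 / 4π) Δφ dA` (taken in the sense of distributions), and this is a semi-positive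
form with coefficients in `L^∞_loc`. -/
structure IsCurvatureDensity (φ ρ : ℂ → ℝ) : Prop where
  measurable : Measurable ρ
  nonneg : ∀ z, 0 ≤ ρ z
  locallyBounded : ∀ R : ℝ, ∃ C : ℝ, ∀ z : ℂ, ‖z‖ ≤ R → ρ z ≤ C
  integral_eq : ∀ χ : ℂ → ℝ, ContDiff ℝ ∞ χ → HasCompactSupport χ →
    ∫ z, φ z * ((4 * Real.pi)⁻¹ * Laplacian.laplacian χ z) = ∫ z, ρ z * χ z

/-- The space `H_{1,1}` of metrics on `O(1) → ℙ¹` with semi-positive curvature current given by an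
`L^∞` form on `ℙ¹`. Local potentials of such a form are `C^{1,α}`, so the metric is continuous. -/
structure IsH11 (h : SqNorm) : Prop where
  homogeneous : ∀ (c : ℂ) (v : Fin 2 → ℂ), h (c • v) = ‖c‖ ^ 2 * h v
  pos : ∀ v : Fin 2 → ℂ, v ≠ 0 → 0 < h v
  continuous : Continuous h
  curvature : ∃ ρ, IsCurvatureDensity (weight h) ρ
  curvatureAtInfinity : ∃ ρ, IsCurvatureDensity (weightAtInfinity h) ρ

/-- Invariance under the standard action of `S¹`, i.e. `z ↦ c z` with `|c| = 1`. -/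
def IsS1Invariant (h : SqNorm) : Prop :=
  ∀ c : ℂ, ‖c‖ = 1 → ∀ v : Fin 2 → ℂ, h ![v 0, c * v 1] = h v

/-! ### The K-energy -/

open Classical in
/-- The density of the curvature form `ω_Φ` in the coordinate `z` (unique almost everywhere). -/
def curvatureDensity (h : SqNorm) : ℂ → ℝ :=
  if H : ∃ ρ, IsCurvatureDensity (weight h) ρ then H.choose else 0

/-- The density of the Fubini-Study form `ω₀ = (i / 2π) ∂∂̄ log (1 + |z|²)`. -/
def fsDensity (z : ℂ) : ℝ := (Real.pi * (1 + ‖z‖ ^ 2) ^ 2)⁻¹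

/-- The density of `Ric ω₀ = -(i / 2π) ∂∂̄ log fsDensity`, a form in `c₁(ℙ¹)`. -/
def ricciDensity (z : ℂ) : ℝ :=
  -((4 * Real.pi)⁻¹ * Laplacian.laplacian (fun w => Real.log (fsDensity w)) z)

/-- `R̄ = n c₁(X) · [ω₀]ⁿ⁻¹ / [ω₀]ⁿ` with `n = 1`. -/
def meanCurvature : ℝ := (∫ z, ricciDensity z) / ∫ z, fsDensity z

/-- The functional `E` with differential `dE_Φ = (n + 1) ω_Φⁿ = 2 ω_Φ` and `E(Φ₀) = 0`, namely
`E(Φ) = ∫ (Φ - Φ₀) (ω_Φ + ω₀)`. Here, as below, the point at infinity may be left out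
of the integrals over `ℙ¹`, since all forms are absolutely continuous. -/
def energy (h : SqNorm) : ℝ :=
  ∫ z, (weight h z - weight fubiniStudy z) * (curvatureDensity h z + fsDensity z)

/-- The functional `E^{Ric ω₀}` with differential `n ω_Φⁿ⁻¹ ∧ Ric ω₀ = Ric ω₀` and value `0`
at `Φ₀`. -/
def ricciEnergy (h : SqNorm) : ℝ :=
  ∫ z, (weight h z - weight fubiniStudy z) * ricciDensity z

/-- The entropy `∫ log (ω_Φ / ω₀) ω_Φ` (with `0 log 0 = 0`). -/
def entropy (h : SqNorm) : ℝ :=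
  ∫ z, Real.log (curvatureDensity h z / fsDensity z) * curvatureDensity h z

/-- Mabuchi's K-energy, extended to `H_{1,1}` by the Chen-Tian formula. -/
def kEnergy (h : SqNorm) : ℝ :=
  (meanCurvature / 2 * energy h - ricciEnergy h) + entropy h

/-! ### Geodesics

A curve `Φ_t`, `0 ≤ t ≤ 1`, gives the metric `Φ_{Re τ}` on the pull-back of `O(1)` to
`ℙ¹ × {0 < Re τ < 1}`; the function `log h_{Re τ}(v)` on `(ℂ² \ {0}) × {0 < Re τ < 1}` is
plurisubharmonic iff the curvature current of this metric is semi-positive. The (weak) geodesic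
between two metrics, i.e. the solution of the homogeneous complex Monge-Ampère equation on
`ℙ¹ × {0 < Re τ < 1}` with the corresponding boundary values, is the Perron envelope: the largest
bounded such curve with these end points. -/

/-- Plurisubharmonicity of a real-valued locally bounded function `U` on `Ω`: upper semicontinuity
and the sub-mean value inequality along all closed holomorphic discs in `Ω`. -/
def IsPlurisubharmonicOn {E : Type*} [NormedAddCommGroup E] [NormedSpace ℂ E]
    (U : E → ℝ) (Ω : Set E) : Prop :=
  UpperSemicontinuousOn U Ω ∧
    ∀ f : ℂ → E, AnalyticOnNhd ℂ f (Metric.closedBall 0 1) →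
      Set.MapsTo f (Metric.closedBall 0 1) Ω →
        U (f 0) ≤ Real.circleAverage (fun ζ => U (f ζ)) 0 1

/-- Bounded curves `h_t`, `0 ≤ t ≤ 1`, of metrics on `O(1)` which are upper semicontinuous up to
the boundary and have semi-positive curvature on `ℙ¹ × {0 < Re τ < 1}` (subgeodesics). -/
structure IsSubgeodesic (h : ℝ → SqNorm) : Prop where
  homogeneous : ∀ t ∈ Set.Icc (0 : ℝ) 1, ∀ (c : ℂ) (v : Fin 2 → ℂ), h t (c • v) = ‖c‖ ^ 2 * h t v
  bounded : ∃ C : ℝ, 0 < C ∧ ∀ t ∈ Set.Icc (0 : ℝ) 1, ∀ v : Fin 2 → ℂ,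
    C⁻¹ * fubiniStudy v ≤ h t v ∧ h t v ≤ C * fubiniStudy v
  usc : UpperSemicontinuousOn (fun p : ℝ × (Fin 2 → ℂ) => h p.1 p.2)
    (Set.Icc (0 : ℝ) 1 ×ˢ Set.univ)
  psh : IsPlurisubharmonicOn (fun p : ℂ × (Fin 2 → ℂ) => Real.log (h p.1.re p.2))
    {p | 0 < p.1.re ∧ p.1.re < 1 ∧ p.2 ≠ 0}

/-- The curve `h_t`, `0 ≤ t ≤ 1`, is a (weak) geodesic. -/
def IsGeodesic (h : ℝ → SqNorm) : Prop :=
  IsSubgeodesic h ∧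
    ∀ k : ℝ → SqNorm, IsSubgeodesic k → (∀ v, k 0 v ≤ h 0 v) → (∀ v, k 1 v ≤ h 1 v) →
      ∀ t ∈ Set.Icc (0 : ℝ) 1, ∀ v, k t v ≤ h t v

/-- A geodesic in `H_{1,1}`. -/
def IsGeodesicInH11 (h : ℝ → SqNorm) : Prop :=
  (∀ t ∈ Set.Icc (0 : ℝ) 1, IsH11 (h t)) ∧ IsGeodesic h

/-- The K-energy is affine along the curve. -/
def KEnergyAffineAlong (h : ℝ → SqNorm) : Prop :=
  ∃ a b : ℝ, ∀ t ∈ Set.Icc (0 : ℝ) 1, kEnergy (h t) = a + b * t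

/-- The curve is of the form `g(t) Φ₀` for a one-parameter subgroup `g` of the automorphism group
`GL₂(ℂ)` of `(ℙ¹, O(1))`, acting by pull-back (the scalar matrices act trivially on `ℙ¹` and by
scaling on `O(1)`). -/
def IsOneParameterOrbit (h : ℝ → SqNorm) : Prop :=
  ∃ g : Multiplicative ℝ →* GL (Fin 2) ℂ, Continuous g ∧
    ∀ t ∈ Set.Icc (0 : ℝ) 1, ∀ v,
      h t v = h 0 ((g (Multiplicative.ofAdd t) : Matrix (Fin 2) (Fin 2) ℂ).mulVec v)

/-- Strict convexity of the K-energy on `H_{1,1}` modulo automorphisms: it is affine only along the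
geodesics induced by one-parameter subgroups of automorphisms. -/
def StrictlyConvexModAutomorphisms : Prop :=
  ∀ h : ℝ → SqNorm, IsGeodesicInH11 h → KEnergyAffineAlong h → IsOneParameterOrbit h

/-! ### Legendre transforms -/

/-- The weight `φ(x) = Φ(z)`, `x = log |z|²`, in logarithmic coordinates. -/
def logWeight (h : SqNorm) (x : ℝ) : ℝ := weight h (Real.exp (x / 2) : ℂ)

/-- The Legendre transform `φ*(y) = sup_x (x y - φ(x))`, with values in `]-∞, ∞]`. -/
def legendre (φ : ℝ → ℝ) (y : ℝ) : EReal := ⨆ x : ℝ, ((x * y - φ x : ℝ) : EReal)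

/-- `u₀(y) = y log y + (1 - y) log (1 - y)`. -/
def symbolFS (y : ℝ) : ℝ := y * Real.log y + (1 - y) * Real.log (1 - y)

/-- `v(y) = max (0, y - 1/2)`. -/
def kink (y : ℝ) : ℝ := max 0 (y - 1 / 2)

end KEnergy

end

open scoped ContDiff

namespace KEnergy

/-! In the variable `x = log |z|²` an S¹-invariant metric is a convex function, and a geodesic is a
curve whose Legendre transforms are affine in `t`; so `u₀ + t v` should define a geodesic. The kink
of `v` at `1/2` becomes a segment on which the weight has slope `1/2`, that is, an annulus `1 < |z|²
< eᵗ` without curvature. On either side of it the metric is Fubini–Study up to dilation and scaling.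
In homogeneous coordinates, with `T = exp (t / 2)`, this is `kinkedForm`: the least of the forms `q
α² + q⁻¹ β²`, `1 ≤ q ≤ T`.

Geodesic: the logarithm of the metric is the attained supremum over `y ∈ [0, 1]` of `(1 - y) log
|v₀|² + y log |v₁|² - u₀(y) - Re τ · v(y)` (`fenchel_le_log_kinkedForm`,
`exists_fenchel_eq_log_kinkedForm`). These functions are plurisubharmonic, hence so is the supremum.
Conversely, through every point passes a holomorphic curve `leaf` along which the logarithm of the
metric is affine in `Re τ`. A competitor restricted to the leaf is a bounded subharmonic function on
a strip, and the maximum principle `le_affine_of_strip` bounds it.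

Regularity: the weight has Lipschitz gradient (`lipschitzWith_clampGradient`), so its curvature
current is given by the pointwise second derivatives, which exist almost everywhere and are bounded.

K-energy: `Ric ω₀ = 2 ω₀`, and `log (ω_Φ / ω₀) = -2 (Φ - Φ₀)` wherever `ω_Φ` does not vanish. Hence
`M(Φ)` collapses to `-∫ (Φ - Φ₀)(ω_Φ + ω₀)`, an elementary integral in `r = |z|²` equal to `t / 4`.
The conceptual reason is that the nonlinear part of `M` depends on the Legendre transform only
through its second derivative almost everywhere, to which `v` contributes nothing.

Not an orbit: the pull-back of the Fubini–Study form by a matrix is a quadratic polynomial along the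
real vectors `(1, x)`, whereas the kinked form is only piecewise quadratic. -/

/-- `α² + β²` for `β ≤ α`, `2 α β` for `α ≤ β ≤ T α` and `T α² + T⁻¹ β²` for `T α ≤ β`. -/
noncomputable def kinkedForm (T α β : ℝ) : ℝ :=
  α ^ 2 + β ^ 2 - (max 0 (β - α)) ^ 2 + T⁻¹ * (max 0 (β - T * α)) ^ 2

/-- The metric on `O(1)` whose Legendre transform is `symbolFS + t * kink`. -/
noncomputable def kinkedMetric (t : ℝ) : SqNorm :=
  fun v => kinkedForm (Real.exp (t / 2)) ‖v 0‖ ‖v 1‖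

/-! ### The kinked form: its three pieces, bounds and homogeneity. -/

lemma kinkedForm_of_le {T α β : ℝ} (hT : 1 ≤ T) (hα : 0 ≤ α) (h : β ≤ α) :
    kinkedForm T α β = α ^ 2 + β ^ 2 := by
  unfold kinkedForm
  rw [max_eq_left (by linarith), max_eq_left (by nlinarith)]
  ring

lemma kinkedForm_of_mem {T α β : ℝ} (h : α ≤ β) (h' : β ≤ T * α) :
    kinkedForm T α β = 2 * α * β := by
  unfold kinkedForm
  rw [max_eq_right (by linarith), max_eq_left (by nlinarith)]
  ring

lemma kinkedForm_of_ge {T α β : ℝ} (hT : 1 ≤ T) (hα : 0 ≤ α) (h : T * α ≤ β) :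
    kinkedForm T α β = T * α ^ 2 + T⁻¹ * β ^ 2 := by
  have : T ≠ 0 := by positivity
  unfold kinkedForm
  rw [max_eq_right (by nlinarith), max_eq_right (by linarith)]
  field_simp
  ring

/-- The kinked form is, at each point, one of the forms `q α² + q⁻¹ β²`, `1 ≤ q ≤ T`. -/
lemma exists_kinkedForm_eq {T α β : ℝ} (hT : 1 ≤ T) (hα : 0 ≤ α) (hβ : 0 ≤ β)
    (h0 : α ≠ 0 ∨ β ≠ 0) :
    ∃ q, 1 ≤ q ∧ q ≤ T ∧ kinkedForm T α β = q * α ^ 2 + q⁻¹ * β ^ 2 ∧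
      ((q = 1 ∧ β ≤ α) ∨ (0 < α ∧ β = q * α) ∨ (q = T ∧ T * α ≤ β)) := by
  rcases le_total β α with h | h
  · exact ⟨1, le_rfl, hT, by rw [kinkedForm_of_le hT hα h]; simp, Or.inl ⟨rfl, h⟩⟩
  rcases le_total (T * α) β with h' | h'
  · exact ⟨T, hT, le_rfl, kinkedForm_of_ge hT hα h', Or.inr (Or.inr ⟨rfl, h'⟩)⟩
  have hα' : 0 < α := by
    rcases hα.eq_or_lt with rfl | h1
    · simp at h'; rcases h0 with h0 | h0
      · exact absurd rfl h0
      · exact absurd (le_antisymm h' hβ) h0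
    · exact h1
  have hβ' : 0 < β := by linarith
  -- This `q` minimises `q α² + q⁻¹ β²`: both terms equal `α β`.
  refine ⟨β / α, (one_le_div hα').2 h, (div_le_iff₀ hα').2 h', ?_, Or.inr (Or.inl ⟨hα', ?_⟩)⟩
  · rw [kinkedForm_of_mem h h']; field_simp; ring
  · field_simp

lemma kinkedForm_pos {T α β : ℝ} (hT : 1 ≤ T) (hα : 0 ≤ α) (hβ : 0 ≤ β)
    (h0 : α ≠ 0 ∨ β ≠ 0) : 0 < kinkedForm T α β := by
  obtain ⟨q, hq, -, h, -⟩ := exists_kinkedForm_eq hT hα hβ h0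
  have : 0 < q := by linarith
  rw [h]
  rcases h0 with h0 | h0 <;> positivity

lemma kinkedForm_le {T α β : ℝ} (hT : 1 ≤ T) (hα : 0 ≤ α) (hβ : 0 ≤ β) :
    kinkedForm T α β ≤ T * (α ^ 2 + β ^ 2) := by
  by_cases h0 : α ≠ 0 ∨ β ≠ 0
  · obtain ⟨q, hq, hqT, h, -⟩ := exists_kinkedForm_eq hT hα hβ h0
    rw [h]
    have : q⁻¹ ≤ T := (inv_le_one_of_one_le₀ hq).trans hT
    nlinarith [sq_nonneg α, sq_nonneg β]
  · push Not at h0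
    simp [h0, kinkedForm]

lemma le_kinkedForm {T α β : ℝ} (hT : 1 ≤ T) (hα : 0 ≤ α) (hβ : 0 ≤ β) :
    T⁻¹ * (α ^ 2 + β ^ 2) ≤ kinkedForm T α β := by
  by_cases h0 : α ≠ 0 ∨ β ≠ 0
  · obtain ⟨q, hq, hqT, h, -⟩ := exists_kinkedForm_eq hT hα hβ h0
    rw [h]
    have h1 : T⁻¹ ≤ q := (inv_le_one_of_one_le₀ hT).trans hq
    have h2 : T⁻¹ ≤ q⁻¹ := by gcongr
    nlinarith [sq_nonneg α, sq_nonneg β]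
  · push Not at h0
    simp [h0, kinkedForm]

lemma kinkedForm_smul {T c : ℝ} (hc : 0 ≤ c) (α β : ℝ) :
    kinkedForm T (c * α) (c * β) = c ^ 2 * kinkedForm T α β := by
  unfold kinkedForm
  rw [← mul_sub, show c * β - T * (c * α) = c * (β - T * α) by ring]
  have h : ∀ x : ℝ, max 0 (c * x) = c * max 0 x := fun x => by
    rw [mul_max_of_nonneg _ _ hc, mul_zero]
  rw [h, h]
  ring

/-! ### Legendre duality -/

/-- This is `log s ≤ s - 1` at `s = a / (y S)`, multiplied by `y`. For `y > 0` the case `a = 0` must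
be excluded, because of the convention `log 0 = 0`. -/
lemma mul_log_le {a S y : ℝ} (hS : 0 < S) (hy : 0 ≤ y) (ha : 0 ≤ a) (h : 0 < y → 0 < a) :
    y * Real.log a - y * Real.log y - y * Real.log S ≤ a / S - y := by
  rcases hy.eq_or_lt with rfl | hy'
  · simp; positivity
  have ha' := h hy'
  have := Real.log_le_sub_one_of_pos (x := a / (y * S)) (by positivity)
  rw [Real.log_div ha'.ne' (by positivity), Real.log_mul hy'.ne' hS.ne'] at this
  have h2 := mul_le_mul_of_nonneg_left this hy
  have h3 : y * (a / (y * S) - 1) = a / S - y := by field_simp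
  linarith

/-- Gibbs' inequality: in the sum of `mul_log_le` for both terms, with `S = a + b`, the right-hand
sides cancel. -/
lemma fenchel_le_log_add {a b y : ℝ} (hy : 0 ≤ y) (hy1 : y ≤ 1) (ha : 0 ≤ a) (hb : 0 ≤ b)
    (hay : y < 1 → 0 < a) (hby : 0 < y → 0 < b) :
    (1 - y) * Real.log a + y * Real.log b - symbolFS y ≤ Real.log (a + b) := by
  have hS : 0 < a + b := by
    rcases hy1.lt_or_eq with h | h
    · have := hay h; linarith
    · have := hby (by rw [h]; norm_num); linarith
  have h1 := mul_log_le hS hy hb hby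
  have h2 := mul_log_le hS (sub_nonneg.2 hy1) ha (fun h => hay (by linarith))
  have h3 : b / (a + b) + a / (a + b) = 1 := by field_simp; ring
  unfold symbolFS
  linarith

/-- The equality case of Gibbs' inequality: `y` is the share of `b` in `a + b`. -/
lemma fenchel_eq_log_add {a b : ℝ} (ha : 0 ≤ a) (hb : 0 ≤ b) (h : 0 < a + b) :
    (1 - b / (a + b)) * Real.log a + b / (a + b) * Real.log b - symbolFS (b / (a + b)) =
      Real.log (a + b) := by
  have h1 : 1 - b / (a + b) = a / (a + b) := by field_simp; ring
  unfold symbolFS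
  rw [h1]
  have key : ∀ c, 0 ≤ c → c / (a + b) * Real.log (c / (a + b)) =
      c / (a + b) * Real.log c - c / (a + b) * Real.log (a + b) := by
    intro c hc
    rcases hc.eq_or_lt with rfl | hc
    · simp
    · rw [Real.log_div hc.ne' h.ne']; ring
  rw [key a ha, key b hb]
  have : a / (a + b) + b / (a + b) = 1 := by field_simp
  linear_combination Real.log (a + b) * this

lemma kink_nonneg (y : ℝ) : 0 ≤ kink y := le_max_left _ _

/-- Young's inequality between the kinked form and its Legendre transform. -/
lemma fenchel_le_log_kinkedForm {t α β y : ℝ} (ht : 0 ≤ t) (hy : 0 ≤ y) (hy1 : y ≤ 1)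
    (hα : 0 ≤ α) (hβ : 0 ≤ β) (hαy : y < 1 → 0 < α) (hβy : 0 < y → 0 < β) :
    (1 - y) * Real.log (α ^ 2) + y * Real.log (β ^ 2) - symbolFS y - t * kink y ≤
      Real.log (kinkedForm (Real.exp (t / 2)) α β) := by
  have hT : 1 ≤ Real.exp (t / 2) := Real.one_le_exp (by linarith)
  have h0 : α ≠ 0 ∨ β ≠ 0 := by
    rcases hy1.lt_or_eq with h | h
    · exact Or.inl (hαy h).ne'
    · exact Or.inr (hβy (by rw [h]; norm_num)).ne'
  obtain ⟨q, hq, hqT, h, -⟩ := exists_kinkedForm_eq hT hα hβ h0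
  have hq0 : 0 < q := by linarith
  rw [h]
  have key := fenchel_le_log_add (a := q * α ^ 2) (b := q⁻¹ * β ^ 2) hy hy1 (by positivity)
    (by positivity) (fun h => by have := hαy h; positivity) (fun h => by have := hβy h; positivity)
  have e1 : (1 - y) * Real.log (q * α ^ 2) = (1 - y) * (Real.log q + Real.log (α ^ 2)) := by
    rcases hy1.lt_or_eq with h | h
    · rw [Real.log_mul hq0.ne' (by have := hαy h; positivity)]
    · simp [h]
  have e2 : y * Real.log (q⁻¹ * β ^ 2) = y * (-Real.log q + Real.log (β ^ 2)) := by
    rcases hy.lt_or_eq with h | h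
    · rw [Real.log_mul (by positivity) (by have := hβy h; positivity), Real.log_inv]
    · simp [← h]
  have hl0 : 0 ≤ Real.log q := Real.log_nonneg hq
  have hl1 : Real.log q ≤ t / 2 := by
    have := Real.log_le_log hq0 hqT
    rwa [Real.log_exp] at this
  have hk0 : 0 ≤ kink y := kink_nonneg y
  have hk1 : y - 1 / 2 ≤ kink y := le_max_right _ _
  -- `t * kink y` is the maximum of `l * (2 y - 1)` over `0 ≤ l ≤ t / 2`, here compared with `l =
  -- log q`.
  have : Real.log q * (2 * y - 1) ≤ t * kink y := by nlinarith
  rw [e1, e2] at key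
  linarith

/-- The supremum in the Legendre transform is attained. -/
lemma exists_fenchel_eq_log_kinkedForm {t α β : ℝ} (ht : 0 ≤ t) (hα : 0 ≤ α) (hβ : 0 ≤ β)
    (h0 : α ≠ 0 ∨ β ≠ 0) :
    ∃ y, 0 ≤ y ∧ y ≤ 1 ∧ (y < 1 → 0 < α) ∧ (0 < y → 0 < β) ∧
      (1 - y) * Real.log (α ^ 2) + y * Real.log (β ^ 2) - symbolFS y - t * kink y =
        Real.log (kinkedForm (Real.exp (t / 2)) α β) := by
  have hT : 1 ≤ Real.exp (t / 2) := Real.one_le_exp (by linarith)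
  obtain ⟨q, hq, hqT, h, hcase⟩ := exists_kinkedForm_eq hT hα hβ h0
  have hq0 : 0 < q := by linarith
  have hS : 0 < q * α ^ 2 + q⁻¹ * β ^ 2 := h ▸ kinkedForm_pos hT hα hβ h0
  have key := fenchel_eq_log_add (a := q * α ^ 2) (b := q⁻¹ * β ^ 2) (by positivity)
    (by positivity) hS
  set y := q⁻¹ * β ^ 2 / (q * α ^ 2 + q⁻¹ * β ^ 2) with hy
  have hy0 : 0 ≤ y := by positivity
  have hy1 : y ≤ 1 := by
    rw [hy, div_le_one hS]; have : 0 ≤ q * α ^ 2 := by positivity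
    linarith
  have hαy : y < 1 → 0 < α := by
    intro h1
    refine hα.lt_of_ne' fun h2 => ?_
    rw [hy, h2] at h1
    rw [h2] at hS
    simp only [ne_eq, OfNat.ofNat_ne_zero, not_false_eq_true, zero_pow, mul_zero, zero_add] at h1 hS
    rw [div_self hS.ne'] at h1
    exact lt_irrefl _ h1
  have hβy : 0 < y → 0 < β := by
    intro h1
    refine hβ.lt_of_ne' fun h2 => ?_
    rw [hy, h2] at h1
    simp at h1
  have e1 : (1 - y) * Real.log (q * α ^ 2) = (1 - y) * (Real.log q + Real.log (α ^ 2)) := by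
    rcases hy1.lt_or_eq with h | h
    · rw [Real.log_mul hq0.ne' (by have := hαy h; positivity)]
    · simp [h]
  have e2 : y * Real.log (q⁻¹ * β ^ 2) = y * (-Real.log q + Real.log (β ^ 2)) := by
    rcases hy0.lt_or_eq with h | h
    · rw [Real.log_mul (by positivity) (by have := hβy h; positivity), Real.log_inv]
    · simp [← h]
  refine ⟨y, hy0, hy1, hαy, hβy, ?_⟩
  -- Complementary slackness: `l = log q` maximises `l * (2 y - 1)` on `[0, t / 2]`, because `l = 0`
  -- comes with `y ≤ 1/2`, an intermediate `l` with `y = 1/2`, and `l = t / 2` with `y ≥ 1/2`.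
  have hlog : t * kink y = Real.log q * (2 * y - 1) := by
    rcases hcase with ⟨h1, h2⟩ | ⟨h1, h2⟩ | ⟨h1, h2⟩
    · have : y ≤ 1 / 2 := by
        rw [hy, div_le_iff₀ hS, h1]; simp; nlinarith
      rw [kink, max_eq_left (by linarith), h1]; simp
    · have : y = 1 / 2 := by
        rw [hy, h2]; field_simp; norm_num
      rw [kink, this]; simp
    · have : 1 / 2 ≤ y := by
        rw [hy, le_div_iff₀ hS]
        have hb : q * α ≤ β := h1 ▸ h2
        have : q * α ^ 2 ≤ q⁻¹ * β ^ 2 := by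
          rw [inv_mul_eq_div, le_div_iff₀ hq0]
          have : 0 ≤ q * α := by positivity
          nlinarith
        linarith
      rw [kink, max_eq_right (by linarith), h1, Real.log_exp]; ring
  rw [e1, e2] at key
  rw [h]
  linarith

/-! ### The metrics in logarithmic coordinates and their Legendre transforms. -/

lemma one_le_exp_half {t : ℝ} (ht : 0 ≤ t) : 1 ≤ Real.exp (t / 2) :=
  Real.one_le_exp (by linarith)

lemma kinkedMetric_zero : kinkedMetric 0 = fubiniStudy := by
  ext v
  simp only [kinkedMetric, kinkedForm, fubiniStudy]
  simp

lemma isS1Invariant_kinkedMetric (t : ℝ) : IsS1Invariant (kinkedMetric t) := by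
  intro c hc v
  simp [kinkedMetric, hc]

lemma logWeight_kinkedMetric (t x : ℝ) :
    logWeight (kinkedMetric t) x =
      Real.log (kinkedForm (Real.exp (t / 2)) 1 (Real.exp (x / 2))) := by
  have : ‖(Real.exp (x / 2) : ℂ)‖ = Real.exp (x / 2) := by
    rw [Complex.norm_real, Real.norm_eq_abs, abs_of_pos (Real.exp_pos _)]
  simp only [logWeight, weight, kinkedMetric, Matrix.cons_val_zero, Matrix.cons_val_one, this,
    norm_one]

lemma log_exp_half_sq (x : ℝ) : Real.log (Real.exp (x / 2) ^ 2) = x := by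
  rw [Real.log_pow, Real.log_exp]; push_cast; ring

lemma logWeight_of_nonpos {t x : ℝ} (ht : 0 ≤ t) (hx : x ≤ 0) :
    logWeight (kinkedMetric t) x = Real.log (1 + Real.exp x) := by
  rw [logWeight_kinkedMetric, kinkedForm_of_le (one_le_exp_half ht) zero_le_one
    (Real.exp_le_one_iff.2 (by linarith)), ← Real.exp_nat_mul]
  norm_num
  ring_nf

lemma logWeight_of_ge {t x : ℝ} (ht : 0 ≤ t) (hx : t ≤ x) :
    logWeight (kinkedMetric t) x = x - t / 2 + Real.log (1 + Real.exp (t - x)) := by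
  rw [logWeight_kinkedMetric, kinkedForm_of_ge (one_le_exp_half ht) zero_le_one
    (by rw [mul_one]; exact Real.exp_le_exp.2 (by linarith))]
  have : Real.exp (t / 2) * 1 ^ 2 + (Real.exp (t / 2))⁻¹ * Real.exp (x / 2) ^ 2 =
      Real.exp (x - t / 2) * (1 + Real.exp (t - x)) := by
    rw [mul_add, ← Real.exp_add, ← Real.exp_neg, ← Real.exp_nat_mul, ← Real.exp_add]
    ring_nf
  rw [this, Real.log_mul (by positivity) (by positivity), Real.log_exp]

open Filter Topology in
lemma tendsto_logWeight_atBot {t : ℝ} (ht : 0 ≤ t) :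
    Tendsto (logWeight (kinkedMetric t)) atBot (𝓝 0) := by
  have h : Tendsto (fun x => Real.log (1 + Real.exp x)) atBot (𝓝 (Real.log (1 + 0))) :=
    (tendsto_const_nhds.add Real.tendsto_exp_atBot).log (by norm_num)
  rw [add_zero, Real.log_one] at h
  refine h.congr' ?_
  filter_upwards [eventually_le_atBot 0] with x hx
  rw [logWeight_of_nonpos ht hx]

open Filter Topology in
lemma tendsto_sub_logWeight_atTop {t : ℝ} (ht : 0 ≤ t) :
    Tendsto (fun x => x - logWeight (kinkedMetric t) x) atTop (𝓝 (t / 2)) := by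
  have h : Tendsto (fun x => t / 2 - Real.log (1 + Real.exp (t - x))) atTop
      (𝓝 (t / 2 - Real.log (1 + 0))) := by
    refine tendsto_const_nhds.sub ((tendsto_const_nhds.add ?_).log (by norm_num))
    exact Real.tendsto_exp_atBot.comp (tendsto_atBot_add_const_left _ t tendsto_neg_atTop_atBot)
  rw [add_zero, Real.log_one, sub_zero] at h
  refine h.congr' ?_
  filter_upwards [eventually_ge_atTop t] with x hx
  rw [logWeight_of_ge ht hx]
  ring

open Filter Topology in
lemma legendre_eq_of_tendsto {φ : ℝ → ℝ} {y L : ℝ} {l : Filter ℝ} [l.NeBot]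
    (h1 : ∀ x, x * y - φ x ≤ L) (h2 : Tendsto (fun x => x * y - φ x) l (𝓝 L)) :
    legendre φ y = L := by
  refine le_antisymm (iSup_le fun x => EReal.coe_le_coe_iff.2 (h1 x)) ?_
  refine le_of_tendsto (EReal.tendsto_coe.2 h2) (.of_forall fun x => ?_)
  exact le_iSup (fun x : ℝ => ((x * y - φ x : ℝ) : EReal)) x

open Filter Topology in
lemma legendre_eq_top_of_tendsto {φ : ℝ → ℝ} {y : ℝ} {l : Filter ℝ} [l.NeBot]
    (h2 : Tendsto (fun x => x * y - φ x) l atTop) :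
    legendre φ y = ⊤ := by
  refine top_unique (le_of_tendsto (EReal.tendsto_coe_atTop.comp h2) (.of_forall fun x => ?_))
  exact le_iSup (fun x : ℝ => ((x * y - φ x : ℝ) : EReal)) x

lemma mul_sub_logWeight_le {t x y : ℝ} (ht : 0 ≤ t) (hy : 0 ≤ y) (hy1 : y ≤ 1) :
    x * y - logWeight (kinkedMetric t) x ≤ symbolFS y + t * kink y := by
  have h := fenchel_le_log_kinkedForm (t := t) (α := 1) (β := Real.exp (x / 2)) ht hy hy1
    zero_le_one (Real.exp_pos _).le (fun _ => one_pos) (fun _ => Real.exp_pos _)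
  rw [log_exp_half_sq, ← logWeight_kinkedMetric] at h
  simp at h
  linarith

lemma exists_mul_sub_logWeight_eq {t y : ℝ} (ht : 0 ≤ t) (hy : 0 < y) (hy1 : y < 1) :
    ∃ x, x * y - logWeight (kinkedMetric t) x = symbolFS y + t * kink y := by
  have hy1' : 0 < 1 - y := by linarith
  rcases le_total y (1 / 2) with h | h
  · have h0 : Real.log y - Real.log (1 - y) ≤ 0 := by
      have := Real.log_le_log hy (show y ≤ 1 - y by linarith)
      linarith
    -- The point where the slope `exp x / (1 + exp x)` equals `y`. The other branch uses its
    -- translate by `t`, the outer piece of the weight being the inner one shifted, plus a constant.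
    refine ⟨Real.log y - Real.log (1 - y), ?_⟩
    rw [logWeight_of_nonpos ht h0, Real.exp_sub, Real.exp_log hy, Real.exp_log hy1',
      show 1 + y / (1 - y) = (1 - y)⁻¹ by field_simp; ring, Real.log_inv, symbolFS, kink,
      max_eq_left (by linarith)]
    ring
  · have h0 : t ≤ t + (Real.log y - Real.log (1 - y)) := by
      have := Real.log_le_log hy1' (show 1 - y ≤ y by linarith)
      linarith
    refine ⟨t + (Real.log y - Real.log (1 - y)), ?_⟩
    rw [logWeight_of_ge ht h0, show t - (t + (Real.log y - Real.log (1 - y))) =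
      Real.log (1 - y) - Real.log y by ring, Real.exp_sub, Real.exp_log hy, Real.exp_log hy1',
      show 1 + (1 - y) / y = y⁻¹ by field_simp; ring, Real.log_inv, symbolFS, kink,
      max_eq_right (by linarith)]
    ring

open Filter Topology in
-- For interior `y` the supremum is attained; at `y = 0` and `y = 1` it is obtained as a limit at
-- `-∞` and `+∞`. For other `y` it is infinite, since the weight is asymptotic to `0` at `-∞` and to
-- `x - t / 2` at `+∞`.
lemma legendre_logWeight_kinkedMetric {t : ℝ} (ht : 0 ≤ t) (y : ℝ) :
    legendre (logWeight (kinkedMetric t)) y =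
      if y ∈ Set.Icc (0 : ℝ) 1 then ((symbolFS y + t * kink y : ℝ) : EReal) else ⊤ := by
  split_ifs with h
  · obtain ⟨hy, hy1⟩ := h
    have hle : ∀ x, x * y - logWeight (kinkedMetric t) x ≤ symbolFS y + t * kink y :=
      fun x => mul_sub_logWeight_le ht hy hy1
    rcases hy.eq_or_lt with rfl | hy
    · refine legendre_eq_of_tendsto (l := atBot) hle ?_
      have := (tendsto_logWeight_atBot ht).neg
      simpa [symbolFS, kink] using this
    rcases hy1.eq_or_lt with rfl | hy1
    · refine legendre_eq_of_tendsto (l := atTop) hle ?_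
      have := tendsto_sub_logWeight_atTop ht
      have e : symbolFS 1 + t * kink 1 = t / 2 := by
        norm_num [symbolFS, kink]; ring
      simpa only [mul_one, e] using this
    obtain ⟨x, hx⟩ := exists_mul_sub_logWeight_eq ht hy hy1
    -- An attained supremum is a limit along `pure x`.
    refine legendre_eq_of_tendsto (l := pure x) hle ?_
    rw [← hx]
    exact tendsto_pure_nhds _ x
  · rcases lt_or_ge y 0 with hy | hy
    · refine legendre_eq_top_of_tendsto (l := atBot) ?_
      simp only [sub_eq_add_neg]
      exact (tendsto_id.atBot_mul_const_of_neg hy).atTop_add (tendsto_logWeight_atBot ht).neg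
    · have hy1 : 1 < y := by
        by_contra h1; exact h ⟨hy, not_lt.1 h1⟩
      refine legendre_eq_top_of_tendsto (l := atTop) ?_
      have := (tendsto_id.atTop_mul_const (sub_pos.2 hy1)).atTop_add
        (tendsto_sub_logWeight_atTop ht)
      refine this.congr fun x => ?_
      simp only [id]; ring

/-! ### The curve is not induced by automorphisms -/

lemma exists_quadratic_fubiniStudy_mulVec (M : Matrix (Fin 2) (Fin 2) ℂ) :
    ∃ p q r : ℝ, ∀ x : ℝ, fubiniStudy (M.mulVec ![1, (x : ℂ)]) = p + q * x + r * x ^ 2 := by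
  refine ⟨Complex.normSq (M 0 0) + Complex.normSq (M 1 0),
    2 * ((M 0 0).re * (M 0 1).re + (M 0 0).im * (M 0 1).im +
      (M 1 0).re * (M 1 1).re + (M 1 0).im * (M 1 1).im),
    Complex.normSq (M 0 1) + Complex.normSq (M 1 1), fun x => ?_⟩
  simp only [fubiniStudy, ← Complex.normSq_eq_norm_sq, Matrix.mulVec, dotProduct, Fin.sum_univ_two,
    Complex.normSq_apply, Matrix.cons_val_zero, Matrix.cons_val_one, Complex.add_re,
    Complex.add_im, Complex.mul_re, Complex.mul_im, Complex.ofReal_re, Complex.ofReal_im,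
    Complex.one_re, Complex.one_im]
  ring

lemma kinkedMetric_real (t : ℝ) {x : ℝ} (hx : 0 ≤ x) :
    kinkedMetric t ![1, (x : ℂ)] = kinkedForm (Real.exp (t / 2)) 1 x := by
  simp [kinkedMetric, abs_of_nonneg hx]

/-- The single matrix `g(1)` already gives a contradiction. The values at `0`, `1/2`, `1` force the
quadratic polynomial to be `1 + x²`; at `x = T = exp (1 / 2)` the form equals `2 T`, which differs
from `1 + T²` by `(T - 1)²`. -/
lemma not_isOneParameterOrbit_kinkedMetric : ¬ IsOneParameterOrbit kinkedMetric := by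
  rintro ⟨g, -, hg⟩
  obtain ⟨p, q, r, h⟩ := exists_quadratic_fubiniStudy_mulVec (g (Multiplicative.ofAdd 1))
  have key : ∀ x : ℝ, 0 ≤ x → kinkedForm (Real.exp (1 / 2)) 1 x = p + q * x + r * x ^ 2 := by
    intro x hx
    rw [← h, ← kinkedMetric_real 1 hx, hg 1 (by simp), kinkedMetric_zero]
  have hT : 1 < Real.exp (1 / 2) := Real.one_lt_exp_iff.2 (by norm_num)
  have h0 := key 0 le_rfl
  have h1 := key 1 zero_le_one
  have h2 := key (1 / 2) (by norm_num)
  have h3 := key (Real.exp (1 / 2)) (by positivity)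
  rw [kinkedForm_of_le hT.le zero_le_one (by norm_num)] at h0 h1 h2
  rw [kinkedForm_of_mem hT.le (by linarith)] at h3
  have hp : p = 1 := by linarith
  have hq : q = 0 := by linarith
  have hr : r = 1 := by linarith
  rw [hp, hq, hr] at h3
  have : 0 < (Real.exp (1 / 2) - 1) ^ 2 := by
    have := sub_pos.2 hT; positivity
  linarith

/-! ### Continuity, homogeneity and bounds of the metrics. -/

lemma continuous_kinkedMetric : Continuous fun p : ℝ × (Fin 2 → ℂ) => kinkedMetric p.1 p.2 := by
  have h : ∀ p : ℝ × (Fin 2 → ℂ), Real.exp (p.1 / 2) ≠ 0 := fun p => (Real.exp_pos _).ne'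
  unfold kinkedMetric kinkedForm
  fun_prop (disch := exact h _)

lemma kinkedMetric_smul (t : ℝ) (c : ℂ) (v : Fin 2 → ℂ) :
    kinkedMetric t (c • v) = ‖c‖ ^ 2 * kinkedMetric t v := by
  simp [kinkedMetric, kinkedForm_smul]

lemma norm_ne_zero_or {v : Fin 2 → ℂ} (hv : v ≠ 0) : ‖v 0‖ ≠ 0 ∨ ‖v 1‖ ≠ 0 := by
  by_contra! h
  apply hv
  ext i
  fin_cases i
  · simpa using h.1
  · simpa using h.2

lemma kinkedMetric_pos {t : ℝ} (ht : 0 ≤ t) {v : Fin 2 → ℂ} (hv : v ≠ 0) :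
    0 < kinkedMetric t v :=
  kinkedForm_pos (one_le_exp_half ht) (norm_nonneg _) (norm_nonneg _) (norm_ne_zero_or hv)

lemma kinkedMetric_le {t : ℝ} (ht : 0 ≤ t) (v : Fin 2 → ℂ) :
    kinkedMetric t v ≤ Real.exp (t / 2) * fubiniStudy v :=
  kinkedForm_le (one_le_exp_half ht) (norm_nonneg _) (norm_nonneg _)

lemma le_kinkedMetric {t : ℝ} (ht : 0 ≤ t) (v : Fin 2 → ℂ) :
    (Real.exp (t / 2))⁻¹ * fubiniStudy v ≤ kinkedMetric t v :=
  le_kinkedForm (one_le_exp_half ht) (norm_nonneg _) (norm_nonneg _)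

lemma fubiniStudy_nonneg (v : Fin 2 → ℂ) : 0 ≤ fubiniStudy v := by
  unfold fubiniStudy; positivity

/-! ### Plurisubharmonicity -/

open Real in
-- By Jensen's formula the difference of the two sides is a sum of nonnegative contributions of the
-- zeros of `f` in the disc.
lemma log_norm_le_circleAverage {f : ℂ → ℂ} (hf : AnalyticOnNhd ℂ f (Metric.closedBall 0 1))
    (h0 : f 0 ≠ 0) : Real.log ‖f 0‖ ≤ circleAverage (fun ζ => Real.log ‖f ζ‖) 0 1 := by
  have hf' : AnalyticOnNhd ℂ f (Metric.closedBall 0 |1|) := by simpa using hf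
  rw [hf'.circleAverage_log_norm one_ne_zero h0]
  refine le_add_of_nonneg_left (finsum_nonneg fun u => ?_)
  by_cases hu : u ∈ Metric.closedBall (0 : ℂ) |1|
  · refine mul_nonneg ?_ ?_
    · have := MeromorphicOn.AnalyticOnNhd.divisor_nonneg hf' u
      exact_mod_cast this
    · simp at hu ⊢
      exact Real.log_nonpos (norm_nonneg _) hu
  · simp [Function.locallyFinsuppWithin.apply_eq_zero_of_notMem _ hu]

open Filter Topology in
-- As `log 0 = 0` instead of `-∞`, lower bounds by `log ‖f‖` may fail at zeros of `f`. These are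
-- isolated, so the comparison on the circle is made off a discrete set.
lemma eventually_ne_zero_codiscreteWithin {f : ℂ → ℂ}
    (hf : AnalyticOnNhd ℂ f (Metric.closedBall 0 1)) (h0 : f 0 ≠ 0) :
    ∀ᶠ ζ in codiscreteWithin (Metric.sphere (0 : ℂ) |1|), f ζ ≠ 0 := by
  have h := hf.preimage_zero_mem_codiscreteWithin (x := 0) h0 (by simp)
    ⟨⟨0, by simp⟩, (convex_closedBall (0 : ℂ) 1).isPreconnected⟩
  rw [abs_one]
  filter_upwards [codiscreteWithin_mono Metric.sphere_subset_closedBall h] with ζ hζ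
  simpa using hζ

open Filter Topology Real in
-- Replacing `f` by `min f g` changes it only on a negligible set.
lemma circleAverage_mono_codiscreteWithin {f g : ℂ → ℝ} {c : ℂ} {R : ℝ} (hR : R ≠ 0)
    (hf : CircleIntegrable f c R) (hg : CircleIntegrable g c R)
    (h : ∀ᶠ z in codiscreteWithin (Metric.sphere c |R|), f z ≤ g z) :
    circleAverage f c R ≤ circleAverage g c R := by
  have h' : f =ᶠ[codiscreteWithin (Metric.sphere c |R|)] fun z => min (f z) (g z) := by
    filter_upwards [h] with z hz
    exact (min_eq_left hz).symm
  rw [circleAverage_congr_codiscreteWithin h' hR]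
  exact circleAverage_mono (hf.congr_codiscreteWithin h') hg fun z _ => min_le_right _ _

open Real in
lemma mul_log_norm_le_circleAverage {f : ℂ → ℂ} {c : ℝ}
    (hf : AnalyticOnNhd ℂ f (Metric.closedBall 0 1)) (hc : 0 ≤ c) (h0 : 0 < c → f 0 ≠ 0) :
    c * Real.log ‖f 0‖ ≤ circleAverage (fun ζ => c * Real.log ‖f ζ‖) 0 1 := by
  have e := circleAverage_fun_smul (a := c) (f := fun ζ => Real.log ‖f ζ‖) (c := 0) (R := 1)
  simp only [smul_eq_mul] at e
  rw [e]
  rcases hc.eq_or_lt with rfl | hc'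
  · simp
  · exact mul_le_mul_of_nonneg_left (log_norm_le_circleAverage hf (h0 hc')) hc

open Real in
lemma circleAverage_re {f : ℂ → ℂ} (hf : AnalyticOnNhd ℂ f (Metric.closedBall 0 1)) :
    circleAverage (fun ζ => (f ζ).re) 0 1 = (f 0).re := by
  refine InnerProductSpace.HarmonicOnNhd.circleAverage_eq fun z hz => ?_
  exact (hf z (by simpa using hz)).harmonicAt_re

open Real in
lemma circleIntegrable_log_norm {f : ℂ → ℂ}
    (hf : AnalyticOnNhd ℂ f (Metric.closedBall 0 1)) :
    CircleIntegrable (fun ζ => Real.log ‖f ζ‖) 0 1 := by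
  refine MeromorphicOn.circleIntegrable_log_norm fun z hz => ?_
  exact (hf z (Metric.sphere_subset_closedBall (by simpa using hz))).meromorphicAt

lemma circleIntegrable_re {f : ℂ → ℂ} (hf : AnalyticOnNhd ℂ f (Metric.closedBall 0 1)) :
    CircleIntegrable (fun ζ => (f ζ).re) 0 1 :=
  ContinuousOn.circleIntegrable zero_le_one
    (Complex.continuous_re.comp_continuousOn (hf.continuousOn.mono Metric.sphere_subset_closedBall))

lemma continuousOn_log_kinkedMetric :
    ContinuousOn (fun p : ℂ × (Fin 2 → ℂ) => Real.log (kinkedMetric p.1.re p.2))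
      {p | 0 < p.1.re ∧ p.1.re < 1 ∧ p.2 ≠ 0} := by
  have h : Continuous fun p : ℂ × (Fin 2 → ℂ) => kinkedMetric p.1.re p.2 :=
    continuous_kinkedMetric.comp
      ((Complex.continuous_re.comp continuous_fst).prodMk continuous_snd)
  exact h.continuousOn.log fun p hp => (kinkedMetric_pos hp.1.le hp.2.2).ne'

open Real Filter Topology in
-- Freeze the `y` that is optimal at the centre of the disc. The resulting minorant is exact at the
-- centre, satisfies the sub-mean value inequality, and lies below the logarithm of the metric on
-- the circle off the zeros of the coordinates. A coordinate with coefficient zero may vanish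
-- identically.
lemma log_kinkedMetric_le_circleAverage {f : ℂ → ℂ × (Fin 2 → ℂ)}
    (hf : AnalyticOnNhd ℂ f (Metric.closedBall 0 1))
    (hΩ : Set.MapsTo f (Metric.closedBall 0 1) {p | 0 < p.1.re ∧ p.1.re < 1 ∧ p.2 ≠ 0}) :
    Real.log (kinkedMetric (f 0).1.re (f 0).2) ≤
      circleAverage (fun ζ => Real.log (kinkedMetric (f ζ).1.re (f ζ).2)) 0 1 := by
  have hτ : AnalyticOnNhd ℂ (fun ζ => (f ζ).1) (Metric.closedBall 0 1) :=
    fun z hz => (ContinuousLinearMap.fst ℂ ℂ (Fin 2 → ℂ)).analyticAt _ |>.comp (hf z hz)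
  have hv : ∀ i, AnalyticOnNhd ℂ (fun ζ => (f ζ).2 i) (Metric.closedBall 0 1) :=
    fun i z hz => ((ContinuousLinearMap.proj (R := ℂ) (φ := fun _ : Fin 2 => ℂ) i).comp
      (ContinuousLinearMap.snd ℂ ℂ (Fin 2 → ℂ))).analyticAt _ |>.comp (hf z hz)
  obtain ⟨ht0, -, hv0⟩ := hΩ (show (0 : ℂ) ∈ Metric.closedBall 0 1 by simp)
  obtain ⟨y, hy, hy1, hαy, hβy, heq⟩ := exists_fenchel_eq_log_kinkedForm ht0.le
    (norm_nonneg ((f 0).2 0)) (norm_nonneg ((f 0).2 1)) (norm_ne_zero_or hv0)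
  simp only [Real.log_pow, Nat.cast_ofNat] at heq
  have h0 : 0 < (1 - y) * 2 → (f 0).2 0 ≠ 0 :=
    fun h => norm_pos_iff.1 (hαy (by linarith))
  have h1 : 0 < y * 2 → (f 0).2 1 ≠ 0 :=
    fun h => norm_pos_iff.1 (hβy (by linarith))
  have I0 := (circleIntegrable_log_norm (hv 0)).const_fun_smul (a := (1 - y) * 2)
  have I1 := (circleIntegrable_log_norm (hv 1)).const_fun_smul (a := y * 2)
  have I2 := (circleIntegrable_re hτ).const_fun_smul (a := kink y)
  have I3 := circleIntegrable_const (symbolFS y) 0 1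
  have A0 := mul_log_norm_le_circleAverage (hv 0) (c := (1 - y) * 2) (by linarith) h0
  have A1 := mul_log_norm_le_circleAverage (hv 1) (c := y * 2) (by linarith) h1
  have A2 := circleAverage_fun_smul (a := kink y) (f := fun ζ => (f ζ).1.re) (c := 0) (R := 1)
  have A3 := circleAverage_const (symbolFS y) 0 1
  rw [circleAverage_re hτ] at A2
  simp only [smul_eq_mul] at I0 I1 I2 A2
  have hI : CircleIntegrable (fun ζ => Real.log (kinkedMetric (f ζ).1.re (f ζ).2)) 0 1 :=
    ContinuousOn.circleIntegrable zero_le_one (continuousOn_log_kinkedMetric.comp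
      (hf.continuousOn.mono Metric.sphere_subset_closedBall)
      (hΩ.mono_left Metric.sphere_subset_closedBall))
  refine le_trans ?_ (circleAverage_mono_codiscreteWithin one_ne_zero
    (((I0.add I1).sub I3).sub I2) hI ?_)
  · rw [circleAverage_sub ((I0.add I1).sub I3) I2, circleAverage_sub (I0.add I1) I3,
      circleAverage_add I0 I1, A2, A3]
    unfold kinkedMetric
    rw [← heq]
    linarith
  · have E0 : ∀ᶠ ζ in codiscreteWithin (Metric.sphere (0 : ℂ) |1|),
        0 < (1 - y) * 2 → (f ζ).2 0 ≠ 0 := by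
      by_cases h : 0 < (1 - y) * 2
      · filter_upwards [eventually_ne_zero_codiscreteWithin (hv 0) (h0 h)] with ζ hζ _ using hζ
      · exact .of_forall fun _ h' => absurd h' h
    have E1 : ∀ᶠ ζ in codiscreteWithin (Metric.sphere (0 : ℂ) |1|),
        0 < y * 2 → (f ζ).2 1 ≠ 0 := by
      by_cases h : 0 < y * 2
      · filter_upwards [eventually_ne_zero_codiscreteWithin (hv 1) (h1 h)] with ζ hζ _ using hζ
      · exact .of_forall fun _ h' => absurd h' h
    filter_upwards [E0, E1, self_mem_codiscreteWithin _] with ζ hζ0 hζ1 hζ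
    have hζ' : ζ ∈ Metric.closedBall (0 : ℂ) 1 :=
      Metric.sphere_subset_closedBall (by simpa using hζ)
    have := fenchel_le_log_kinkedForm (hΩ hζ').1.le hy hy1 (norm_nonneg ((f ζ).2 0))
      (norm_nonneg ((f ζ).2 1)) (fun h => norm_pos_iff.2 (hζ0 (by linarith)))
      (fun h => norm_pos_iff.2 (hζ1 (by linarith)))
    simp only [Real.log_pow, Nat.cast_ofNat] at this
    simp only [Pi.sub_apply, Pi.add_apply, kinkedMetric]
    linarith

lemma isSubgeodesic_kinkedMetric : IsSubgeodesic kinkedMetric where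
  homogeneous t _ c v := kinkedMetric_smul t c v
  bounded := by
    refine ⟨Real.exp (1 / 2), Real.exp_pos _, fun t ht v => ⟨?_, ?_⟩⟩
    · refine le_trans ?_ (le_kinkedMetric ht.1 v)
      have := fubiniStudy_nonneg v
      gcongr
      exact ht.2
    · refine (kinkedMetric_le ht.1 v).trans ?_
      have := fubiniStudy_nonneg v
      gcongr
      exact ht.2
  usc := continuous_kinkedMetric.continuousOn.upperSemicontinuousOn
  psh := ⟨continuousOn_log_kinkedMetric.upperSemicontinuousOn,
    fun _ hf hΩ => log_kinkedMetric_le_circleAverage hf hΩ⟩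

/-! ### A maximum principle on the strip -/

/-- A quadratic function which is strictly superharmonic for `ε > 0`. -/
noncomputable def stripBarrier (a b ε : ℝ) (z : ℂ) : ℝ :=
  a + b * z.re + ε * (z.im ^ 2 + 2 - 2 * z.re ^ 2)

lemma continuous_stripBarrier (a b ε : ℝ) : Continuous (stripBarrier a b ε) := by
  unfold stripBarrier
  fun_prop

open Real in
-- One has `im² - 2 re² = -3/2 Re z² - 1/2 |z|²`, and `|z|² = |p|² + r² + 2 Re (p̄ (z - p))` on the
-- circle. So the barrier agrees there with the real part of the polynomial `G`, whose average is
-- its value at `p`.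
lemma circleAverage_stripBarrier (a b ε : ℝ) (p : ℂ) (r : ℝ) :
    circleAverage (stripBarrier a b ε) p r = stripBarrier a b ε p - ε * r ^ 2 / 2 := by
  set G : ℂ → ℂ := fun z => a + b * z + ε * (2 - 3 / 2 * z ^ 2 -
    1 / 2 * ((Complex.normSq p + r ^ 2 : ℝ) + 2 * (starRingEnd ℂ p) * (z - p))) with hG
  have hGa : InnerProductSpace.HarmonicOnNhd (fun z => (G z).re) (Metric.closedBall p |r|) := by
    intro z _
    refine AnalyticAt.harmonicAt_re ?_
    rw [hG]
    fun_prop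
  rw [circleAverage_congr_sphere (f₂ := fun z => (G z).re), hGa.circleAverage_eq]
  · simp [hG, stripBarrier, Complex.normSq_apply, pow_two]
    ring
  · intro z hz
    have h : Complex.normSq (z - p) = r ^ 2 := by
      rw [mem_sphere_iff_norm] at hz
      rw [Complex.normSq_eq_norm_sq, hz, sq_abs]
    rw [Complex.normSq_apply] at h
    simp only [Complex.sub_re, Complex.sub_im] at h
    simp [hG, stripBarrier, Complex.normSq_apply, pow_two] at h ⊢
    left
    linear_combination (-1 / 2) * h

open Real in
-- On a large rectangle `U - stripBarrier` attains its maximum. A positive maximum cannot lie on the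
-- boundary, and at an interior one the average over a small circle would lose `ε r² / 2`, against
-- the sub-mean value inequality.
lemma le_stripBarrier {U : ℂ → ℝ} {a b C ε : ℝ}
    (husc : UpperSemicontinuousOn U {z | 0 ≤ z.re ∧ z.re ≤ 1})
    (hC : ∀ z : ℂ, 0 ≤ z.re → z.re ≤ 1 → |U z| ≤ C)
    (hmean : ∀ (p : ℂ) (r : ℝ), 0 < r → Metric.closedBall p r ⊆ {z | 0 < z.re ∧ z.re < 1} →
      U p ≤ circleAverage U p r)
    (h0 : ∀ z : ℂ, z.re = 0 → U z ≤ a) (h1 : ∀ z : ℂ, z.re = 1 → U z ≤ a + b) (hε : 0 < ε)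
    {z : ℂ} (hz0 : 0 ≤ z.re) (hz1 : z.re ≤ 1) :
    U z ≤ stripBarrier a b ε z := by
  -- At height `R` the term `ε R²` outweighs `U` and the affine part, which rules out the horizontal
  -- sides.
  obtain ⟨R, hR, hzR, hRR⟩ : ∃ R : ℝ, 0 ≤ R ∧ |z.im| ≤ R ∧ C + |a| + |b| ≤ ε * R ^ 2 := by
    refine ⟨|z.im| + 1 + (C + |a| + |b|) / ε, ?_, ?_, ?_⟩
    all_goals
      have hC0 : 0 ≤ C := (abs_nonneg _).trans (hC z hz0 hz1)
      have hX : 0 ≤ (C + |a| + |b|) / ε := by positivity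
    · positivity
    · linarith
    · have h2 : (C + |a| + |b|) / ε ≤ (|z.im| + 1 + (C + |a| + |b|) / ε) ^ 2 := by
        nlinarith [abs_nonneg z.im]
      calc C + |a| + |b| = ε * ((C + |a| + |b|) / ε) := by field_simp
        _ ≤ _ := by gcongr
  set K : Set ℂ := Set.Icc 0 1 ×ℂ Set.Icc (-R) R with hK
  have hKc : IsCompact K := isCompact_Icc.reProdIm isCompact_Icc
  have hzK : z ∈ K := Complex.mem_reProdIm.2 ⟨⟨hz0, hz1⟩, abs_le.1 hzR⟩
  have husc' : UpperSemicontinuousOn (fun z => U z + -stripBarrier a b ε z) K := by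
    refine (husc.mono fun w hw => (Complex.mem_reProdIm.1 hw).1).add ?_
    exact (continuous_stripBarrier a b ε).neg.continuousOn.upperSemicontinuousOn
  obtain ⟨p, hpK, hp⟩ := husc'.exists_isMaxOn ⟨z, hzK⟩ hKc
  have hp' : ∀ w ∈ K, U w + -stripBarrier a b ε w ≤ U p + -stripBarrier a b ε p := hp
  suffices U p ≤ stripBarrier a b ε p by linarith [hp' z hzK]
  by_contra! hcon
  obtain ⟨⟨hp0, hp1⟩, hpR, hpR'⟩ := Complex.mem_reProdIm.1 hpK
  have hq : 0 ≤ p.im ^ 2 + 2 - 2 * p.re ^ 2 := by nlinarith [sq_nonneg p.im]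
  have hlow : a + b * p.re ≤ stripBarrier a b ε p := by
    unfold stripBarrier
    nlinarith
  have hp0 : 0 < p.re := by
    refine hp0.lt_of_ne' fun h => ?_
    have := h0 p h
    rw [h] at hlow
    linarith
  have hp1 : p.re < 1 := by
    refine hp1.lt_of_ne fun h => ?_
    have := h1 p h
    rw [h] at hlow
    linarith
  have hpim : |p.im| < R := by
    refine (abs_le.2 ⟨hpR, hpR'⟩).lt_of_ne fun h => ?_
    have h2 : R ^ 2 = p.im ^ 2 := by rw [← h, sq_abs]
    have h3 := (le_abs_self _).trans (hC p hp0.le hp1.le)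
    have h4 : -|b| ≤ b * p.re := by
      have := neg_abs_le (b * p.re)
      rw [abs_mul, abs_of_pos hp0] at this
      nlinarith [abs_nonneg b]
    have h5 : ε * R ^ 2 ≤ ε * (p.im ^ 2 + 2 - 2 * p.re ^ 2) := by
      rw [h2]; gcongr; nlinarith
    unfold stripBarrier at hcon
    linarith [neg_abs_le a]
  obtain ⟨r, hr, hball⟩ : ∃ r > 0, Metric.closedBall p r ⊆
      {w : ℂ | 0 < w.re ∧ w.re < 1 ∧ |w.im| < R} := by
    have hop : IsOpen {w : ℂ | 0 < w.re ∧ w.re < 1 ∧ |w.im| < R} :=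
      (isOpen_lt continuous_const Complex.continuous_re).inter
        ((isOpen_lt Complex.continuous_re continuous_const).inter
          (isOpen_lt Complex.continuous_im.abs continuous_const))
    exact Metric.nhds_basis_closedBall.mem_iff.1 (hop.mem_nhds ⟨hp0, hp1, hpim⟩)
  have hsph : ∀ θ, circleMap p r θ ∈ {w : ℂ | 0 < w.re ∧ w.re < 1 ∧ |w.im| < R} :=
    fun θ => hball (circleMap_mem_closedBall p hr.le θ)
  have hUI : CircleIntegrable U p r := by
    have hm : Measurable fun θ => U (circleMap p r θ) := by
      refine UpperSemicontinuous.measurable ?_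
      rw [← upperSemicontinuousOn_univ_iff]
      exact husc.comp (continuous_circleMap p r).continuousOn
        fun θ _ => ⟨(hsph θ).1.le, (hsph θ).2.1.le⟩
    refine (intervalIntegrable_const (c := C)).mono_fun hm.aestronglyMeasurable (.of_forall ?_)
    intro θ
    have h3 := hC _ (hsph θ).1.le (hsph θ).2.1.le
    change |U (circleMap p r θ)| ≤ |C|
    exact h3.trans (le_abs_self C)
  have hBI : CircleIntegrable (stripBarrier a b ε) p r :=
    (continuous_stripBarrier a b ε).continuousOn.circleIntegrable hr.le
  have hcI := circleIntegrable_const (U p - stripBarrier a b ε p) p r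
  have key := (hmean p r hr fun w hw => ⟨(hball hw).1, (hball hw).2.1⟩).trans
    (circleAverage_mono hUI (hBI.add hcI) fun w hw => by
      rw [abs_of_pos hr] at hw
      obtain ⟨ha, hb, hc⟩ := hball (Metric.sphere_subset_closedBall hw)
      have := hp' w (Complex.mem_reProdIm.2 ⟨⟨ha.le, hb.le⟩, abs_le.1 hc.le⟩)
      simp only [Pi.add_apply]
      linarith)
  rw [circleAverage_add hBI hcI, circleAverage_stripBarrier, circleAverage_const] at key
  have : 0 < ε * r ^ 2 / 2 := by positivity
  linarith

open Real in
/-- A bounded subharmonic function on the strip `0 ≤ Re z ≤ 1` which lies below an affine function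
of `Re z` on the boundary lies below it on the strip. -/
lemma le_affine_of_strip {U : ℂ → ℝ} {a b C : ℝ}
    (husc : UpperSemicontinuousOn U {z | 0 ≤ z.re ∧ z.re ≤ 1})
    (hC : ∀ z : ℂ, 0 ≤ z.re → z.re ≤ 1 → |U z| ≤ C)
    (hmean : ∀ (p : ℂ) (r : ℝ), 0 < r → Metric.closedBall p r ⊆ {z | 0 < z.re ∧ z.re < 1} →
      U p ≤ circleAverage U p r)
    (h0 : ∀ z : ℂ, z.re = 0 → U z ≤ a) (h1 : ∀ z : ℂ, z.re = 1 → U z ≤ a + b)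
    {z : ℂ} (hz0 : 0 ≤ z.re) (hz1 : z.re ≤ 1) :
    U z ≤ a + b * z.re := by
  have hq : 0 < z.im ^ 2 + 2 - 2 * z.re ^ 2 + 1 := by nlinarith [sq_nonneg z.im]
  refine le_of_forall_pos_le_add fun δ hδ => ?_
  -- This `ε` makes the quadratic term of the barrier at `z` at most `δ`.
  have := le_stripBarrier husc hC hmean h0 h1
    (div_pos hδ hq) hz0 hz1
  unfold stripBarrier at this
  have h2 : δ / (z.im ^ 2 + 2 - 2 * z.re ^ 2 + 1) * (z.im ^ 2 + 2 - 2 * z.re ^ 2) ≤ δ := by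
    rw [div_mul_eq_mul_div, div_le_iff₀ hq]
    nlinarith
  linarith

/-! ### The leaves of the geodesic -/

/-- The curve `τ ↦ (v₀, exp (s (τ - t) / 2) v₁)`. -/
noncomputable def leaf (v : Fin 2 → ℂ) (s t : ℝ) (τ : ℂ) : Fin 2 → ℂ :=
  ![v 0, Complex.exp (s * (τ - t) / 2) * v 1]

lemma leaf_self (v : Fin 2 → ℂ) (s t : ℝ) : leaf v s t t = v := by
  ext i; fin_cases i <;> simp [leaf]

lemma leaf_ne_zero {v : Fin 2 → ℂ} (hv : v ≠ 0) (s t : ℝ) (τ : ℂ) : leaf v s t τ ≠ 0 := by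
  intro h
  apply hv
  have h0 := congrFun h 0
  have h1 := congrFun h 1
  simp only [leaf, Matrix.cons_val_zero, Matrix.cons_val_one, Pi.zero_apply, mul_eq_zero,
    Complex.exp_ne_zero, false_or] at h0 h1
  ext i; fin_cases i
  · exact h0
  · exact h1

lemma norm_leaf_one (v : Fin 2 → ℂ) (s t : ℝ) (τ : ℂ) :
    ‖leaf v s t τ 1‖ = Real.exp (s * (τ.re - t) / 2) * ‖v 1‖ := by
  have : (s * (τ - t) / 2 : ℂ).re = s * (τ.re - t) / 2 := by
    rw [show (s * (τ - t) / 2 : ℂ) = ((s / 2 : ℝ) : ℂ) * (τ - (t : ℂ)) by push_cast; ring,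
      Complex.re_ofReal_mul]
    simp; ring
  simp [leaf, Complex.norm_exp, this]

lemma differentiable_leaf (v : Fin 2 → ℂ) (s t : ℝ) : Differentiable ℂ (leaf v s t) := by
  rw [differentiable_pi]
  intro i
  fin_cases i
  · simp [leaf]
  · change Differentiable ℂ fun τ : ℂ => Complex.exp (s * (τ - t) / 2) * v 1
    fun_prop

/-- The speed `s` is a subgradient of `kink` at the dual variable `y`: `0` inside the annulus, `1`
outside it. Within the annulus `y = 1/2` and all `s ∈ [0, 1]` occur. -/
lemma exists_leaf_log_kinkedMetric {t : ℝ} (ht : 0 ≤ t) (v : Fin 2 → ℂ) :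
    ∃ s, 0 ≤ s ∧ s ≤ 1 ∧ ∃ a b, ∀ τ : ℂ, 0 ≤ τ.re →
      Real.log (kinkedMetric τ.re (leaf v s t τ)) = a + b * τ.re := by
  have hT := one_le_exp_half ht
  rcases le_or_gt ‖v 1‖ ‖v 0‖ with h | h
  · refine ⟨0, le_rfl, zero_le_one, Real.log (‖v 0‖ ^ 2 + ‖v 1‖ ^ 2), 0, fun τ hτ => ?_⟩
    simp only [kinkedMetric, norm_leaf_one]
    rw [show ‖leaf v 0 t τ 0‖ = ‖v 0‖ by simp [leaf]]
    simp [kinkedForm_of_le (one_le_exp_half hτ) (norm_nonneg _) h]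
  rcases le_or_gt (Real.exp (t / 2) * ‖v 0‖) ‖v 1‖ with h' | h'
  · refine ⟨1, zero_le_one, le_rfl, Real.log (‖v 0‖ ^ 2 + Real.exp (-t) * ‖v 1‖ ^ 2), 1 / 2,
      fun τ hτ => ?_⟩
    simp only [kinkedMetric, norm_leaf_one]
    rw [show ‖leaf v 1 t τ 0‖ = ‖v 0‖ by simp [leaf]]
    have e : Real.exp (1 * (τ.re - t) / 2) = Real.exp (τ.re / 2) * (Real.exp (t / 2))⁻¹ := by
      rw [← Real.exp_neg, ← Real.exp_add]; ring_nf
    have hle : ‖v 0‖ ≤ (Real.exp (t / 2))⁻¹ * ‖v 1‖ := by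
      rw [inv_mul_eq_div, le_div_iff₀ (Real.exp_pos _)]; linarith
    rw [e, kinkedForm_of_ge (one_le_exp_half hτ) (norm_nonneg _)
      (by rw [mul_assoc]; gcongr)]
    have e2 : Real.exp (τ.re / 2) * ‖v 0‖ ^ 2 + (Real.exp (τ.re / 2))⁻¹ *
        (Real.exp (τ.re / 2) * (Real.exp (t / 2))⁻¹ * ‖v 1‖) ^ 2 =
        Real.exp (τ.re / 2) * (‖v 0‖ ^ 2 + Real.exp (-t) * ‖v 1‖ ^ 2) := by
      have : Real.exp (-t) = (Real.exp (t / 2))⁻¹ ^ 2 := by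
        rw [← Real.exp_neg, ← Real.exp_nat_mul]; ring_nf
      rw [this]
      field_simp
    have : 0 < ‖v 1‖ := (norm_nonneg _).trans_lt h
    rw [e2, Real.log_mul (by positivity) (by positivity), Real.log_exp]
    ring
  · have h1 : 0 < ‖v 1‖ := (norm_nonneg _).trans_lt h
    have h0 : 0 < ‖v 0‖ := by
      by_contra! h2
      have h3 : ‖v 0‖ = 0 := le_antisymm h2 (norm_nonneg _)
      rw [h3] at h'
      linarith
    set x := Real.log (‖v 1‖ / ‖v 0‖) with hx
    have hx0 : 0 ≤ x := Real.log_nonneg ((one_le_div h0).2 h.le)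
    have hxt : x < t / 2 := by
      rw [hx, Real.log_lt_iff_lt_exp (by positivity), div_lt_iff₀ h0]
      exact h'
    have ht0 : 0 < t := by linarith
    have hs1 : 2 * x / t ≤ 1 := by rw [div_le_one ht0]; linarith
    have hs0 : 0 ≤ 2 * x / t := by positivity
    -- The leaf issues from `|v₀| = |v₁|` at time `0` and has logarithmic coordinate `2 x` at time
    -- `t`, hence `s t = 2 x`.
    refine ⟨2 * x / t, hs0, hs1, Real.log (2 * ‖v 0‖ ^ 2), x / t, fun τ hτ => ?_⟩
    simp only [kinkedMetric, norm_leaf_one]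
    rw [show ‖leaf v (2 * x / t) t τ 0‖ = ‖v 0‖ by simp [leaf]]
    have e : Real.exp (2 * x / t * (τ.re - t) / 2) * ‖v 1‖ =
        Real.exp (x / t * τ.re) * ‖v 0‖ := by
      have e1 : ‖v 1‖ = Real.exp x * ‖v 0‖ := by
        rw [hx, Real.exp_log (by positivity)]; field_simp
      rw [e1, ← mul_assoc, ← Real.exp_add]
      congr 2
      field_simp
      ring
    rw [e, kinkedForm_of_mem]
    · rw [show 2 * ‖v 0‖ * (Real.exp (x / t * τ.re) * ‖v 0‖) =
        2 * ‖v 0‖ ^ 2 * Real.exp (x / t * τ.re) by ring, Real.log_mul (by positivity)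
        (by positivity), Real.log_exp]
    · have : 1 ≤ Real.exp (x / t * τ.re) := Real.one_le_exp (by positivity)
      nlinarith
    · gcongr
      have : 2 * x / t * τ.re ≤ 1 * τ.re := by gcongr
      linarith [show 2 * x / t * τ.re = 2 * (x / t * τ.re) by ring]

lemma fubiniStudy_leaf_bounds {v : Fin 2 → ℂ} {s t : ℝ} (hs : 0 ≤ s) (hs1 : s ≤ 1) (ht : 0 ≤ t)
    (ht1 : t ≤ 1) {τ : ℂ} (hτ : 0 ≤ τ.re) (hτ1 : τ.re ≤ 1) :
    Real.exp (-1) * fubiniStudy v ≤ fubiniStudy (leaf v s t τ) ∧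
      fubiniStudy (leaf v s t τ) ≤ Real.exp 1 * fubiniStudy v := by
  have e : fubiniStudy (leaf v s t τ) = ‖v 0‖ ^ 2 + Real.exp (s * (τ.re - t)) * ‖v 1‖ ^ 2 := by
    rw [fubiniStudy, norm_leaf_one, mul_pow, ← Real.exp_nat_mul]
    simp only [leaf, Matrix.cons_val_zero]
    congr 3
    push_cast; ring
  have h1 : Real.exp (s * (τ.re - t)) ≤ Real.exp 1 := Real.exp_le_exp.2 (by nlinarith)
  have h2 : Real.exp (-1) ≤ Real.exp (s * (τ.re - t)) := Real.exp_le_exp.2 (by nlinarith)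
  have h3 : 1 ≤ Real.exp 1 := Real.one_le_exp zero_le_one
  have h4 : Real.exp (-1) ≤ 1 := Real.exp_le_one_iff.2 (by norm_num)
  rw [e, fubiniStudy]
  constructor <;> nlinarith [sq_nonneg ‖v 0‖, sq_nonneg ‖v 1‖]

lemma IsSubgeodesic.pos {k : ℝ → SqNorm} (hk : IsSubgeodesic k) {t : ℝ} (ht : t ∈ Set.Icc (0 : ℝ) 1)
    {v : Fin 2 → ℂ} (hv : v ≠ 0) : 0 < k t v := by
  obtain ⟨C, hC, hb⟩ := hk.bounded
  have : 0 < fubiniStudy v := by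
    unfold fubiniStudy
    rcases norm_ne_zero_or hv with h | h <;> positivity
  exact lt_of_lt_of_le (by positivity) (hb t ht v).1

lemma IsSubgeodesic.le_kinkedMetric {k : ℝ → SqNorm} (hk : IsSubgeodesic k)
    (h0 : ∀ v, k 0 v ≤ kinkedMetric 0 v) (h1 : ∀ v, k 1 v ≤ kinkedMetric 1 v)
    {t : ℝ} (ht : t ∈ Set.Icc (0 : ℝ) 1) (v : Fin 2 → ℂ) : k t v ≤ kinkedMetric t v := by
  rcases eq_or_ne v 0 with rfl | hv
  · have e1 := hk.homogeneous t ht 0 0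
    have e2 := kinkedMetric_smul t 0 0
    simp at e1 e2
    rw [e1, e2]
  obtain ⟨s, hs0, hs1, a, b, hab⟩ := exists_leaf_log_kinkedMetric ht.1 v
  have hF : 0 < fubiniStudy v := by
    unfold fubiniStudy
    rcases norm_ne_zero_or hv with h | h <;> positivity
  obtain ⟨C, hC, hb⟩ := hk.bounded
  have hlc : Continuous (leaf v s t) := (differentiable_leaf v s t).continuous
  have hkpos : ∀ τ : ℂ, 0 ≤ τ.re → τ.re ≤ 1 → 0 < k τ.re (leaf v s t τ) :=
    fun τ h h' => hk.pos ⟨h, h'⟩ (leaf_ne_zero hv s t τ)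
  have husc : UpperSemicontinuousOn (fun τ : ℂ => Real.log (k τ.re (leaf v s t τ)))
      {z | 0 ≤ z.re ∧ z.re ≤ 1} := by
    have h : UpperSemicontinuousOn (fun τ : ℂ => k τ.re (leaf v s t τ))
        {z | 0 ≤ z.re ∧ z.re ≤ 1} :=
      hk.usc.comp (Complex.continuous_re.prodMk hlc).continuousOn fun τ hτ => ⟨hτ, trivial⟩
    intro τ hτ c hc
    have hc' : k τ.re (leaf v s t τ) < Real.exp c :=
      (Real.log_lt_iff_lt_exp (hkpos τ hτ.1 hτ.2)).1 hc
    filter_upwards [h τ hτ _ hc', self_mem_nhdsWithin] with σ hσ hσ'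
    exact (Real.log_lt_iff_lt_exp (hkpos σ hσ'.1 hσ'.2)).2 hσ
  have hbd : ∀ τ : ℂ, 0 ≤ τ.re → τ.re ≤ 1 → |Real.log (k τ.re (leaf v s t τ))| ≤
      |Real.log (C⁻¹ * (Real.exp (-1) * fubiniStudy v))| +
      |Real.log (C * (Real.exp 1 * fubiniStudy v))| := by
    intro τ hτ hτ1
    obtain ⟨b1, b2⟩ := hb τ.re ⟨hτ, hτ1⟩ (leaf v s t τ)
    obtain ⟨b3, b4⟩ := fubiniStudy_leaf_bounds (v := v) hs0 hs1 ht.1 ht.2 hτ hτ1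
    have hp := hkpos τ hτ hτ1
    have c1 : C⁻¹ * (Real.exp (-1) * fubiniStudy v) ≤ k τ.re (leaf v s t τ) :=
      le_trans (by gcongr) b1
    have c2 : k τ.re (leaf v s t τ) ≤ C * (Real.exp 1 * fubiniStudy v) :=
      b2.trans (by gcongr)
    have d1 := Real.log_le_log (by positivity) c1
    have d2 := Real.log_le_log hp c2
    rw [abs_le]
    constructor
    · linarith [neg_abs_le (Real.log (C⁻¹ * (Real.exp (-1) * fubiniStudy v))),
        abs_nonneg (Real.log (C * (Real.exp 1 * fubiniStudy v)))]
    · linarith [le_abs_self (Real.log (C * (Real.exp 1 * fubiniStudy v))),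
        abs_nonneg (Real.log (C⁻¹ * (Real.exp (-1) * fubiniStudy v)))]
  have hmean : ∀ (p : ℂ) (r : ℝ), 0 < r →
      Metric.closedBall p r ⊆ {z | 0 < z.re ∧ z.re < 1} →
      Real.log (k p.re (leaf v s t p)) ≤
        Real.circleAverage (fun τ : ℂ => Real.log (k τ.re (leaf v s t τ))) p r := by
    intro p r hr hball
    -- Plurisubharmonicity is stated for unit discs, so the disc of centre `p` and radius `r` is
    -- reparametrised by `ζ ↦ r ζ + p`.
    have hd : Differentiable ℂ fun ζ : ℂ => (r * ζ + p, leaf v s t (r * ζ + p)) := by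
      refine Differentiable.prodMk (by fun_prop) ?_
      exact (differentiable_leaf v s t).comp (by fun_prop)
    have := hk.psh.2 (fun ζ : ℂ => (r * ζ + p, leaf v s t (r * ζ + p)))
      (fun z _ => hd.analyticAt z) (fun ζ hζ => by
        have h2 : (r * ζ + p : ℂ) ∈ Metric.closedBall p r := by
          simp only [mem_closedBall_iff_norm, sub_zero, add_sub_cancel_right, norm_mul,
            Complex.norm_real, Real.norm_eq_abs, abs_of_pos hr] at hζ ⊢
          nlinarith
        exact ⟨(hball h2).1, (hball h2).2, leaf_ne_zero hv _ _ _⟩)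
    rw [Real.circleAverage_eq_circleAverage_zero_one]
    simpa using this
  have hlog : ∀ τ : ℂ, 0 ≤ τ.re → τ.re ≤ 1 →
      k τ.re (leaf v s t τ) ≤ kinkedMetric τ.re (leaf v s t τ) →
      Real.log (k τ.re (leaf v s t τ)) ≤ a + b * τ.re := by
    intro τ h h' hle
    rw [← hab τ h]
    exact Real.log_le_log (hkpos τ h h') hle
  have key := le_affine_of_strip husc hbd hmean (a := a) (b := b)
    (fun τ h => by
      have := hlog τ h.ge (by rw [h]; exact zero_le_one) (by rw [h]; exact h0 _)
      rwa [h, mul_zero, add_zero, ← h] at this)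
    (fun τ h => by
      have := hlog τ (by rw [h]; exact zero_le_one) h.le (by rw [h]; exact h1 _)
      rwa [h, mul_one, ← h] at this)
    (z := (t : ℂ)) (by simpa using ht.1) (by simpa using ht.2)
  have := hab t (by simpa using ht.1)
  rw [← this] at key
  simp only [Complex.ofReal_re, leaf_self] at key
  exact (Real.log_le_log_iff (hk.pos ht hv) (kinkedMetric_pos ht.1 hv)).1 key

lemma isGeodesic_kinkedMetric : IsGeodesic kinkedMetric :=
  ⟨isSubgeodesic_kinkedMetric, fun _ hk h0 h1 _ ht v => hk.le_kinkedMetric h0 h1 ht v⟩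

/-! ### Curvature of `C^{1,1}` metrics -/

open MeasureTheory in
/-- Integration by parts for a Lipschitz function with Lipschitz derivative along `v`. -/
lemma integral_mul_lineDeriv_lineDeriv {φ G χ : ℂ → ℝ} {v : ℂ} {C D : NNReal}
    (hφ : LipschitzWith C φ) (hG : LipschitzWith D G) (hderiv : ∀ z, lineDeriv ℝ φ z v = G z)
    (hχ : ContDiff ℝ ∞ χ) (hχc : HasCompactSupport χ) :
    ∫ z, φ z * fderiv ℝ (fderiv ℝ χ) z v v = ∫ z, lineDeriv ℝ G z v * χ z := by
  have hd : Differentiable ℝ χ := hχ.differentiable (by simp)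
  have hd1 : ContDiff ℝ ∞ (fderiv ℝ χ) := hχ.fderiv_right (by simp)
  set g : ℂ → ℝ := fun z => fderiv ℝ χ z v with hg
  have hgs : ContDiff ℝ ∞ g := hd1.clm_apply contDiff_const
  have hgc : HasCompactSupport g := hχc.fderiv_apply (𝕜 := ℝ) v
  obtain ⟨C1, h1⟩ := ContDiff.lipschitzWith_of_hasCompactSupport hχc hχ (by simp)
  obtain ⟨C2, h2⟩ := ContDiff.lipschitzWith_of_hasCompactSupport hgc hgs (by simp)
  have e1 := hφ.integral_lineDeriv_mul_eq (μ := volume) h2 hgc v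
  have e2 := hG.integral_lineDeriv_mul_eq (μ := volume) h1 hχc v
  have l1 : ∀ z, lineDeriv ℝ g z (-v) = - fderiv ℝ (fderiv ℝ χ) z v v := by
    intro z
    rw [lineDeriv_neg, ((hgs.differentiable (by simp)) z).lineDeriv_eq_fderiv, hg,
      fderiv_clm_apply ((hd1.differentiable (by simp)) z) (by fun_prop)]
    simp
  have l2 : ∀ z, lineDeriv ℝ χ z (-v) = - g z := by
    intro z
    rw [lineDeriv_neg, (hd z).lineDeriv_eq_fderiv]
  simp only [l1, hderiv] at e1
  simp only [l2] at e2
  rw [e2]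
  have : ∫ z, φ z * fderiv ℝ (fderiv ℝ χ) z v v =
      - ∫ z, -(fderiv ℝ (fderiv ℝ χ) z v v) * φ z := by
    rw [← integral_neg]; congr 1; ext z; ring
  rw [this, ← e1, ← integral_neg]
  congr 1; ext z; ring

open MeasureTheory in
-- A Lipschitz gradient is differentiable almost everywhere and can be integrated by parts, so the
-- distributional Laplacian has no singular part.
lemma integral_mul_laplacian {φ ρ : ℂ → ℝ} {G : ℂ → ℂ → ℝ} {C D : NNReal}
    (hφ : LipschitzWith C φ) (hG : ∀ v, ‖v‖ = 1 → LipschitzWith D (G v))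
    (hderiv : ∀ v z, lineDeriv ℝ φ z v = G v z)
    (hρ : ∀ᵐ z, lineDeriv ℝ (G 1) z 1 + lineDeriv ℝ (G Complex.I) z Complex.I =
      4 * Real.pi * ρ z) {χ : ℂ → ℝ} (hχ : ContDiff ℝ ∞ χ) (hχc : HasCompactSupport χ) :
    ∫ z, φ z * ((4 * Real.pi)⁻¹ * Laplacian.laplacian χ z) = ∫ z, ρ z * χ z := by
  have hd1 : ContDiff ℝ ∞ (fderiv ℝ χ) := hχ.fderiv_right (by simp)
  have hd2 : ContDiff ℝ ∞ (fderiv ℝ (fderiv ℝ χ)) := hd1.fderiv_right (by simp)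
  have I1 : ∀ v, Integrable fun z => φ z * fderiv ℝ (fderiv ℝ χ) z v v := by
    intro v
    refine Continuous.integrable_of_hasCompactSupport ?_ ?_
    · have := hφ.continuous
      have := hd2.continuous
      fun_prop
    · have h2 : HasCompactSupport (fderiv ℝ (fderiv ℝ χ)) := (hχc.fderiv ℝ).fderiv ℝ
      refine HasCompactSupport.mul_left ?_
      exact h2.comp_left (g := fun L : ℂ →L[ℝ] ℂ →L[ℝ] ℝ => L v v) (by simp)
  have I2 : ∀ v, ‖v‖ = 1 → Integrable fun z => lineDeriv ℝ (G v) z v * χ z := by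
    intro v hv
    have := ((hG v hv).locallyIntegrable_lineDeriv (μ := volume)
      v).integrable_smul_right_of_hasCompactSupport hχ.continuous hχc
    simpa [mul_comm] using this
  have e : ∀ z, φ z * ((4 * Real.pi)⁻¹ * Laplacian.laplacian χ z) = (4 * Real.pi)⁻¹ *
      (φ z * fderiv ℝ (fderiv ℝ χ) z 1 1 + φ z * fderiv ℝ (fderiv ℝ χ) z Complex.I Complex.I) := by
    intro z
    rw [InnerProductSpace.laplacian_eq_iteratedFDeriv_complexPlane]
    simp only [iteratedFDeriv_two_apply, Matrix.cons_val_zero, Matrix.cons_val_one]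
    ring
  simp only [e]
  rw [integral_const_mul, integral_add (I1 _) (I1 _),
    integral_mul_lineDeriv_lineDeriv hφ (hG 1 (by simp)) (hderiv 1) hχ hχc,
    integral_mul_lineDeriv_lineDeriv hφ (hG Complex.I (by simp)) (hderiv Complex.I) hχ hχc,
    ← integral_add (I2 _ (by simp)) (I2 _ (by simp)), ← integral_const_mul]
  refine integral_congr_ae ?_
  filter_upwards [hρ] with z hz
  rw [← add_mul, hz]
  field_simp

/-! ### Radial potentials of class `C^{1,1}` -/

/-- The projection of `r` to the interval `[A, B]`. -/
noncomputable def clamp (A B r : ℝ) : ℝ := max A (min r B)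

/-- The primitive of `1 / (r + clamp A B r)` on `[0, ∞[` given by `log (r + A)` near `0`,
up to a constant. -/
noncomputable def clampPotential (A B r : ℝ) : ℝ :=
  Real.log (r + clamp A B r) - 1 / 2 * Real.log (clamp A B r)

open Classical in
/-- The curvature density of `clampPotential A B ‖z‖²`. -/
noncomputable def clampDensity (A B : ℝ) (z : ℂ) : ℝ :=
  if A < ‖z‖ ^ 2 ∧ ‖z‖ ^ 2 < B then 0
  else clamp A B (‖z‖ ^ 2) / (Real.pi * (‖z‖ ^ 2 + clamp A B (‖z‖ ^ 2)) ^ 2)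

section clamp

variable {A B : ℝ}

lemma le_clamp (A B r : ℝ) : A ≤ clamp A B r := le_max_left _ _

lemma clamp_of_le {r : ℝ} (h : r ≤ A) : clamp A B r = A :=
  max_eq_left ((min_le_left _ _).trans h)

lemma clamp_of_mem {r : ℝ} (h : A ≤ r) (h' : r ≤ B) : clamp A B r = r := by
  rw [clamp, min_eq_left h', max_eq_right h]

lemma clamp_of_ge {r : ℝ} (hAB : A ≤ B) (h : B ≤ r) : clamp A B r = B := by
  rw [clamp, min_eq_right h, max_eq_right hAB]

lemma continuous_clamp (A B : ℝ) : Continuous (clamp A B) := by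
  unfold clamp; fun_prop

open Filter Topology in
-- The three branches match to first order at `A` and `B`, so each one-sided derivative can be read
-- off a single branch.
lemma hasDerivAt_clampPotential (hA : 0 < A) (hAB : A ≤ B) {r : ℝ} (hr : 0 ≤ r) :
    HasDerivAt (clampPotential A B) (r + clamp A B r)⁻¹ r := by
  have hB : 0 < B := hA.trans_le hAB
  have d1 : ∀ c : ℝ, 0 < c → HasDerivAt (fun s => Real.log (s + c) - 1 / 2 * Real.log c)
      (r + c)⁻¹ r := by
    intro c hc
    have := ((hasDerivAt_id r).add_const c).log (by simp; positivity)
    simpa using this.sub_const (1 / 2 * Real.log c)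
  have d2 : 0 < r → HasDerivAt (fun s => Real.log (s + s) - 1 / 2 * Real.log s) (r + r)⁻¹ r := by
    intro hr
    have h1 := ((hasDerivAt_id r).add (hasDerivAt_id r)).log (by simp; positivity)
    have h2 := ((hasDerivAt_id r).log hr.ne').const_mul (1 / 2)
    refine (h1.sub h2).congr_deriv ?_
    simp
    field_simp
    ring
  have hle : HasDerivWithinAt (clampPotential A B) (r + clamp A B r)⁻¹ (Set.Iic r) r := by
    rcases le_or_gt r A with h | h
    · rw [clamp_of_le h]
      refine (d1 A hA).hasDerivWithinAt.congr (fun s hs => ?_) ?_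
      · rw [clampPotential, clamp_of_le (le_trans hs h)]
      · rw [clampPotential, clamp_of_le h]
    rcases le_or_gt r B with h' | h'
    · rw [clamp_of_mem h.le h']
      refine (d2 (hA.trans h)).hasDerivWithinAt.congr_of_eventuallyEq ?_ ?_
      · filter_upwards [self_mem_nhdsWithin, mem_nhdsWithin_of_mem_nhds (lt_mem_nhds h)] with s hs hs'
        rw [clampPotential, clamp_of_mem hs'.le (le_trans hs h')]
      · rw [clampPotential, clamp_of_mem h.le h']
    · rw [clamp_of_ge hAB h'.le]
      refine (d1 B hB).hasDerivWithinAt.congr_of_eventuallyEq ?_ ?_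
      · filter_upwards [mem_nhdsWithin_of_mem_nhds (lt_mem_nhds h')] with s hs
        rw [clampPotential, clamp_of_ge hAB hs.le]
      · rw [clampPotential, clamp_of_ge hAB h'.le]
  have hge : HasDerivWithinAt (clampPotential A B) (r + clamp A B r)⁻¹ (Set.Ici r) r := by
    rcases lt_or_ge r A with h | h
    · rw [clamp_of_le h.le]
      refine (d1 A hA).hasDerivWithinAt.congr_of_eventuallyEq ?_ ?_
      · filter_upwards [mem_nhdsWithin_of_mem_nhds (gt_mem_nhds h)] with s hs
        rw [clampPotential, clamp_of_le hs.le]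
      · rw [clampPotential, clamp_of_le h.le]
    rcases lt_or_ge r B with h' | h'
    · rw [clamp_of_mem h h'.le]
      refine (d2 (hA.trans_le h)).hasDerivWithinAt.congr_of_eventuallyEq ?_ ?_
      · filter_upwards [self_mem_nhdsWithin, mem_nhdsWithin_of_mem_nhds (gt_mem_nhds h')] with s hs hs'
        rw [clampPotential, clamp_of_mem (le_trans h hs) hs'.le]
      · rw [clampPotential, clamp_of_mem h h'.le]
    · rw [clamp_of_ge hAB h']
      refine (d1 B hB).hasDerivWithinAt.congr (fun s hs => ?_) ?_
      · rw [clampPotential, clamp_of_ge hAB (le_trans h' hs)]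
      · rw [clampPotential, clamp_of_ge hAB h']
  have := hle.union hge
  rwa [Set.Iic_union_Ici, hasDerivWithinAt_univ] at this

lemma hasFDerivAt_clampPotential (hA : 0 < A) (hAB : A ≤ B) (z : ℂ) :
    HasFDerivAt (fun z : ℂ => clampPotential A B (‖z‖ ^ 2))
      ((‖z‖ ^ 2 + clamp A B (‖z‖ ^ 2))⁻¹ • (2 • innerSL ℝ z)) z :=
  HasDerivAt.comp_hasFDerivAt (h₂ := clampPotential A B) z
    (hasDerivAt_clampPotential hA hAB (sq_nonneg _))
    (hasStrictFDerivAt_norm_sq z).hasFDerivAt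

/-- The derivative of the potential `clampPotential A B ‖z‖²` in the direction `v`. -/
noncomputable def clampGradient (A B : ℝ) (v z : ℂ) : ℝ :=
  2 * inner ℝ ((‖z‖ ^ 2 + clamp A B (‖z‖ ^ 2))⁻¹ • z) v

lemma lineDeriv_clampPotential (hA : 0 < A) (hAB : A ≤ B) (v z : ℂ) :
    lineDeriv ℝ (fun z : ℂ => clampPotential A B (‖z‖ ^ 2)) z v = clampGradient A B v z := by
  have h := hasFDerivAt_clampPotential hA hAB z
  rw [h.differentiableAt.lineDeriv_eq_fderiv, h.fderiv, clampGradient, inner_smul_left]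
  simp
  ring

/-- The square root is monotone, so it turns truncation of `x²` to `[A, B]` into truncation of `x`
to `[√A, √B]`, which is 1-Lipschitz. -/
lemma sqrt_clamp_sub_le (A B : ℝ) {x y : ℝ} (hx : 0 ≤ x) (hy : 0 ≤ y) :
    |√(clamp A B (x ^ 2)) - √(clamp A B (y ^ 2))| ≤ |x - y| := by
  have h : ∀ x : ℝ, 0 ≤ x → √(clamp A B (x ^ 2)) = max (√A) (min x (√B)) := by
    intro x hx
    have hm : Monotone Real.sqrt := fun _ _ => Real.sqrt_le_sqrt
    rw [clamp, hm.map_max, hm.map_min, Real.sqrt_sq hx]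
  rw [h x hx, h y hy, max_comm (√A), max_comm (√A)]
  refine (abs_max_sub_max_le_abs _ _ _).trans ((abs_min_sub_min_le_max _ _ _ _).trans ?_)
  simp

/-- Writing the clamps as `p²` and `q²` makes the denominators `x² + p²` and `y² + q²`, with `|p -
q| ≤ ‖z - w‖`. Moving the vector costs `1 / A`, changing the coefficient `3 / A`. -/
lemma norm_inv_smul_sub_inv_smul_clamp_le (hA : 0 < A) (z w : ℂ) :
    ‖(‖z‖ ^ 2 + clamp A B (‖z‖ ^ 2))⁻¹ • z - (‖w‖ ^ 2 + clamp A B (‖w‖ ^ 2))⁻¹ • w‖ ≤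
      4 / A * ‖z - w‖ := by
  have hc : ∀ r, 0 < clamp A B r := fun r => hA.trans_le (le_clamp A B r)
  have hpq := sqrt_clamp_sub_le A B (norm_nonneg z) (norm_nonneg w)
  have hp2 : √(clamp A B (‖z‖ ^ 2)) ^ 2 = clamp A B (‖z‖ ^ 2) := Real.sq_sqrt (hc _).le
  have hq2 : √(clamp A B (‖w‖ ^ 2)) ^ 2 = clamp A B (‖w‖ ^ 2) := Real.sq_sqrt (hc _).le
  have ha2 : √A ^ 2 = A := Real.sq_sqrt hA.le
  have hap : √A ≤ √(clamp A B (‖z‖ ^ 2)) := Real.sqrt_le_sqrt (le_clamp _ _ _)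
  have haq : √A ≤ √(clamp A B (‖w‖ ^ 2)) := Real.sqrt_le_sqrt (le_clamp _ _ _)
  have ha : 0 < √A := Real.sqrt_pos.2 hA
  have hxy : |‖z‖ - ‖w‖| ≤ ‖z - w‖ := abs_norm_sub_norm_le z w
  rw [← hp2, ← hq2]
  have hx := norm_nonneg z
  have hy := norm_nonneg w
  have hd := norm_nonneg (z - w)
  set x := ‖z‖
  set y := ‖w‖
  set d := ‖z - w‖ with hd_def
  set p := √(clamp A B (x ^ 2))
  set q := √(clamp A B (y ^ 2))
  set a := √A
  have hp0 : 0 < p := ha.trans_le hap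
  have hq0 : 0 < q := ha.trans_le haq
  have hm : 0 < x ^ 2 + p ^ 2 := by positivity
  have hn : 0 < y ^ 2 + q ^ 2 := by positivity
  have hinv : |(x ^ 2 + p ^ 2)⁻¹ - (y ^ 2 + q ^ 2)⁻¹| ≤
      d * (x + y + p + q) / ((x ^ 2 + p ^ 2) * (y ^ 2 + q ^ 2)) := by
    rw [inv_sub_inv hm.ne' hn.ne', abs_div, abs_of_pos (mul_pos hm hn)]
    gcongr
    rw [show y ^ 2 + q ^ 2 - (x ^ 2 + p ^ 2) = -((x - y) * (x + y) + (p - q) * (p + q)) by ring,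
      abs_neg]
    refine (abs_add_le _ _).trans ?_
    rw [abs_mul, abs_mul, abs_of_nonneg (show 0 ≤ x + y by positivity),
      abs_of_nonneg (show 0 ≤ p + q by positivity)]
    have h1 : |x - y| * (x + y) ≤ d * (x + y) := by gcongr
    have h2 : |p - q| * (p + q) ≤ d * (p + q) := by
      gcongr
      exact hpq.trans hxy
    linarith
  have hbound : A * ((x + y + p + q) * y) ≤ 3 * ((x ^ 2 + p ^ 2) * (y ^ 2 + q ^ 2)) := by
    have h1 : 2 * (a * y) ≤ y ^ 2 + q ^ 2 := by
      nlinarith [sq_nonneg (y - q), mul_le_mul_of_nonneg_right haq hy]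
    have h2 : a * (x + p) ≤ 3 / 2 * (x ^ 2 + p ^ 2) := by
      nlinarith [sq_nonneg (x - p), mul_le_mul_of_nonneg_right hap (add_nonneg hx (ha.trans_le hap).le)]
    have h3 : (y + q) * y ≤ 3 / 2 * (y ^ 2 + q ^ 2) := by
      nlinarith [sq_nonneg (y - q)]
    have h4 : A ≤ x ^ 2 + p ^ 2 := by nlinarith [sq_nonneg x]
    have h5 : (a * y) * (a * (x + p)) ≤
        (1 / 2 * (y ^ 2 + q ^ 2)) * (3 / 2 * (x ^ 2 + p ^ 2)) := by
      exact mul_le_mul (by linarith) h2 (by positivity) (by positivity)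
    have h6 : A * ((y + q) * y) ≤ (x ^ 2 + p ^ 2) * (3 / 2 * (y ^ 2 + q ^ 2)) := by
      gcongr
    have h7 : (a * y) * (a * (x + p)) = A * ((x + p) * y) := by rw [← ha2]; ring
    have h8 : 0 ≤ (x ^ 2 + p ^ 2) * (y ^ 2 + q ^ 2) := by positivity
    nlinarith
  have e : (x ^ 2 + p ^ 2)⁻¹ • z - (y ^ 2 + q ^ 2)⁻¹ • w =
      (x ^ 2 + p ^ 2)⁻¹ • (z - w) + ((x ^ 2 + p ^ 2)⁻¹ - (y ^ 2 + q ^ 2)⁻¹) • w := by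
    rw [smul_sub, sub_smul]; abel
  rw [e]
  refine (norm_add_le _ _).trans ?_
  rw [norm_smul, norm_smul, Real.norm_eq_abs, Real.norm_eq_abs, abs_of_pos (inv_pos.2 hm)]
  have g1 : (x ^ 2 + p ^ 2)⁻¹ * d ≤ 1 / A * d := by
    gcongr
    rw [one_div]
    gcongr
    nlinarith [sq_nonneg x]
  have g2 : |(x ^ 2 + p ^ 2)⁻¹ - (y ^ 2 + q ^ 2)⁻¹| * y ≤ 3 / A * d := by
    refine (mul_le_mul_of_nonneg_right hinv hy).trans ?_
    rw [div_mul_eq_mul_div, div_mul_eq_mul_div, div_le_div_iff₀ (mul_pos hm hn) hA]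
    nlinarith
  calc _ ≤ 1 / A * d + 3 / A * d := add_le_add g1 g2
    _ = 4 / A * d := by ring

lemma lipschitzWith_clampGradient (hA : 0 < A) {v : ℂ} (hv : ‖v‖ = 1) :
    LipschitzWith (Real.toNNReal (8 / A)) (clampGradient A B v) := by
  refine LipschitzWith.of_dist_le_mul fun z w => ?_
  rw [Real.coe_toNNReal _ (by positivity), Real.dist_eq, dist_eq_norm, clampGradient,
    clampGradient, ← mul_sub, ← inner_sub_left, abs_mul, abs_two]
  have h1 := abs_real_inner_le_norm ((‖z‖ ^ 2 + clamp A B (‖z‖ ^ 2))⁻¹ • z -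
    (‖w‖ ^ 2 + clamp A B (‖w‖ ^ 2))⁻¹ • w) v
  rw [hv, mul_one] at h1
  have h2 := norm_inv_smul_sub_inv_smul_clamp_le (B := B) hA z w
  calc _ ≤ 2 * (4 / A * ‖z - w‖) := by linarith
    _ = 8 / A * ‖z - w‖ := by ring

lemma lipschitzWith_clampPotential (hA : 0 < A) (hAB : A ≤ B) :
    LipschitzWith (Real.toNNReal (2 * √A⁻¹)) (fun z : ℂ => clampPotential A B (‖z‖ ^ 2)) := by
  refine lipschitzWith_of_nnnorm_fderiv_le
    (fun z => (hasFDerivAt_clampPotential hA hAB z).differentiableAt) fun z => ?_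
  rw [← NNReal.coe_le_coe, Real.coe_toNNReal _ (by positivity), coe_nnnorm,
    (hasFDerivAt_clampPotential hA hAB z).fderiv]
  have hc := hA.trans_le (le_clamp A B (‖z‖ ^ 2))
  have hm : 0 < ‖z‖ ^ 2 + clamp A B (‖z‖ ^ 2) := by positivity
  rw [norm_smul, norm_inv, Real.norm_of_nonneg hm.le, ← Nat.cast_smul_eq_nsmul ℝ, norm_smul,
    innerSL_apply_norm, inv_mul_le_iff₀ hm, Real.sqrt_inv]
  have h2 : √A ^ 2 = A := Real.sq_sqrt hA.le
  have h3 : 0 < √A := Real.sqrt_pos.2 hA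
  have : √A * ‖z‖ ≤ ‖z‖ ^ 2 + clamp A B (‖z‖ ^ 2) := by
    nlinarith [sq_nonneg (√A - ‖z‖), norm_nonneg z, le_clamp A B (‖z‖ ^ 2)]
  rw [← mul_assoc, mul_comm _ (2 : ℝ), mul_assoc]
  norm_num
  rw [le_mul_inv_iff₀ h3]
  linarith

open Filter Topology in
lemma hasDerivAt_clamp (hAB : A ≤ B) {r : ℝ} (h1 : r ≠ A) (h2 : r ≠ B) :
    HasDerivAt (clamp A B) (if A < r ∧ r < B then 1 else 0) r := by
  rcases h1.lt_or_gt with h | h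
  · rw [if_neg (by intro h'; linarith [h'.1])]
    refine (hasDerivAt_const r A).congr_of_eventuallyEq ?_
    filter_upwards [gt_mem_nhds h] with s hs using clamp_of_le hs.le
  rcases h2.lt_or_gt with h' | h'
  · rw [if_pos ⟨h, h'⟩]
    refine (hasDerivAt_id r).congr_of_eventuallyEq ?_
    filter_upwards [lt_mem_nhds h, gt_mem_nhds h'] with s hs hs' using clamp_of_mem hs.le hs'.le
  · rw [if_neg (by intro h'; linarith [h'.2])]
    refine (hasDerivAt_const r B).congr_of_eventuallyEq ?_
    filter_upwards [lt_mem_nhds h'] with s hs using clamp_of_ge hAB hs.le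

lemma lineDeriv_clampGradient (hA : 0 < A) (hAB : A ≤ B) {z : ℂ} (h1 : ‖z‖ ^ 2 ≠ A)
    (h2 : ‖z‖ ^ 2 ≠ B) {v : ℂ} (hv : ‖v‖ = 1) :
    lineDeriv ℝ (clampGradient A B v) z v = 2 * (‖z‖ ^ 2 + clamp A B (‖z‖ ^ 2))⁻¹ -
      4 * (1 + if A < ‖z‖ ^ 2 ∧ ‖z‖ ^ 2 < B then 1 else 0) * (inner ℝ z v) ^ 2 /
        (‖z‖ ^ 2 + clamp A B (‖z‖ ^ 2)) ^ 2 := by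
  have hc := hA.trans_le (le_clamp A B (‖z‖ ^ 2))
  have hm : 0 < ‖z‖ ^ 2 + clamp A B (‖z‖ ^ 2) := by positivity
  have hn : HasFDerivAt (fun z : ℂ => ‖z‖ ^ 2) (2 • innerSL ℝ z) z :=
    (hasStrictFDerivAt_norm_sq z).hasFDerivAt
  have d1 : HasDerivAt (fun r => (r + clamp A B r)⁻¹)
      (-(1 + if A < ‖z‖ ^ 2 ∧ ‖z‖ ^ 2 < B then 1 else 0) /
        (‖z‖ ^ 2 + clamp A B (‖z‖ ^ 2)) ^ 2) (‖z‖ ^ 2) :=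
    ((hasDerivAt_id _).add (hasDerivAt_clamp hAB h1 h2)).inv hm.ne'
  have d2 := HasDerivAt.comp_hasFDerivAt (h₂ := fun r => (r + clamp A B r)⁻¹) z d1 hn
  have d3 : HasFDerivAt (fun w : ℂ => inner ℝ w v) (innerSL ℝ v) z := by
    have := (innerSL ℝ v).hasFDerivAt (x := z)
    refine this.congr_of_eventuallyEq (.of_forall fun w => ?_)
    simp [real_inner_comm]
  have d4 := (d2.mul d3).const_mul 2
  have e : clampGradient A B v = fun w => 2 * (((fun r : ℝ => (r + clamp A B r)⁻¹) ∘
      (fun w : ℂ => ‖w‖ ^ 2) : ℂ → ℝ) * (fun w => inner ℝ w v : ℂ → ℝ)) w := by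
    ext w
    simp only [clampGradient, real_inner_smul_left, Function.comp, Pi.mul_apply]
  rw [e, d4.differentiableAt.lineDeriv_eq_fderiv, d4.fderiv]
  simp only [Function.comp, smul_apply, add_apply,
    innerSL_apply_apply, smul_eq_mul, real_inner_self_eq_norm_sq, hv, nsmul_eq_mul]
  push_cast
  ring

open MeasureTheory in
lemma ae_norm_sq_ne {A : ℝ} (hA : 0 < A) : ∀ᵐ z : ℂ, ‖z‖ ^ 2 ≠ A := by
  have := Measure.addHaar_sphere_of_ne_zero (volume : Measure ℂ) 0 (Real.sqrt_pos.2 hA).ne'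
  refine measure_mono_null (fun z hz => ?_) this
  simp only [ne_eq, Set.mem_compl_iff, Set.mem_ofPred_eq, not_not] at hz
  rw [mem_sphere_zero_iff_norm, ← hz, Real.sqrt_sq (norm_nonneg z)]

lemma clampDensity_nonneg (hA : 0 < A) (z : ℂ) : 0 ≤ clampDensity A B z := by
  have hc := hA.trans_le (le_clamp A B (‖z‖ ^ 2))
  unfold clampDensity
  split_ifs <;> positivity

lemma measurable_clampDensity (A B : ℝ) : Measurable (clampDensity A B) := by
  have h := (continuous_clamp A B).measurable
  unfold clampDensity
  refine Measurable.ite ?_ measurable_const (by fun_prop)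
  have hn : Measurable fun z : ℂ => ‖z‖ ^ 2 := by fun_prop
  exact (measurableSet_lt measurable_const hn).inter (measurableSet_lt hn measurable_const)

lemma clampDensity_le (hA : 0 < A) (z : ℂ) : clampDensity A B z ≤ (Real.pi * A)⁻¹ := by
  have hc := le_clamp A B (‖z‖ ^ 2)
  have hc0 := hA.trans_le hc
  unfold clampDensity
  split_ifs
  · positivity
  · rw [div_le_iff₀ (by positivity), inv_mul_eq_div, le_div_iff₀ (by positivity)]
    have : clamp A B (‖z‖ ^ 2) * A ≤ (‖z‖ ^ 2 + clamp A B (‖z‖ ^ 2)) ^ 2 := by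
      nlinarith [sq_nonneg ‖z‖]
    nlinarith [Real.pi_pos]

lemma isCurvatureDensity_clampPotential (hA : 0 < A) (hAB : A ≤ B) :
    IsCurvatureDensity (fun z => clampPotential A B (‖z‖ ^ 2)) (clampDensity A B) where
  measurable := measurable_clampDensity A B
  nonneg := clampDensity_nonneg hA
  locallyBounded _ := ⟨_, fun z _ => clampDensity_le hA z⟩
  integral_eq χ hχ hχc := by
    refine integral_mul_laplacian (lipschitzWith_clampPotential hA hAB)
      (fun v hv => lipschitzWith_clampGradient (B := B) hA hv)
      (lineDeriv_clampPotential hA hAB) ?_ hχ hχc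
    filter_upwards [ae_norm_sq_ne hA, ae_norm_sq_ne (hA.trans_le hAB)] with z h1 h2
    rw [lineDeriv_clampGradient hA hAB h1 h2 (by simp),
      lineDeriv_clampGradient hA hAB h1 h2 (by simp)]
    have hn : (inner ℝ z 1) ^ 2 + (inner ℝ z Complex.I) ^ 2 = ‖z‖ ^ 2 := by
      rw [← Complex.normSq_eq_norm_sq, Complex.normSq_apply]
      simp [Complex.inner]
      ring
    have hc := hA.trans_le (le_clamp A B (‖z‖ ^ 2))
    have hm : 0 < ‖z‖ ^ 2 + clamp A B (‖z‖ ^ 2) := by positivity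
    unfold clampDensity
    have hπ := Real.pi_pos
    split_ifs with h
    -- On the open annulus the potential is `log ‖z‖` up to a constant, hence harmonic.
    · have h3 : clamp A B (‖z‖ ^ 2) = ‖z‖ ^ 2 := clamp_of_mem h.1.le h.2.le
      rw [h3] at hm ⊢
      have h4 : ‖z‖ ≠ 0 := by rintro h5; rw [h5] at hm; norm_num at hm
      field_simp
      linear_combination (-4) * hn
    · field_simp
      linear_combination (-4) * hn

end clamp

/-! ### The curve lies in `H_{1,1}` -/

lemma log_half_sq {x : ℝ} : 1 / 2 * Real.log (x ^ 2) = Real.log x := by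
  rw [Real.log_pow]; push_cast; ring

lemma log_kinkedForm_one_left {T β : ℝ} (hT : 1 ≤ T) (hβ : 0 ≤ β) :
    Real.log (kinkedForm T 1 β) = clampPotential 1 (T ^ 2) (β ^ 2) := by
  have hT0 : 0 < T := by linarith
  rw [clampPotential]
  rcases le_total β 1 with h | h
  · rw [kinkedForm_of_le hT zero_le_one h, clamp_of_le (by nlinarith)]
    simp [add_comm]
  rcases le_total β T with h' | h'
  · rw [kinkedForm_of_mem h (by linarith), clamp_of_mem (by nlinarith) (by nlinarith),
      log_half_sq, ← Real.log_div (by positivity) (by positivity)]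
    congr 1
    field_simp
    ring
  · rw [kinkedForm_of_ge hT zero_le_one (by linarith), clamp_of_ge (by nlinarith) (by nlinarith),
      log_half_sq, ← Real.log_div (by positivity) (by positivity)]
    congr 1
    field_simp
    ring

/-- In the chart at infinity the flat annulus is `T⁻² < |w|² < 1`. -/
lemma log_kinkedForm_one_right {T α : ℝ} (hT : 1 ≤ T) (hα : 0 ≤ α) :
    Real.log (kinkedForm T α 1) = clampPotential (T⁻¹ ^ 2) 1 (α ^ 2) := by
  have hT0 : 0 < T := by linarith
  have hT1 : T⁻¹ ≤ 1 := inv_le_one_of_one_le₀ hT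
  have hTi : 0 < T⁻¹ := by positivity
  rw [clampPotential]
  rcases le_total 1 α with h | h
  · rw [kinkedForm_of_le hT hα h, clamp_of_ge (by nlinarith) (by nlinarith)]
    simp
  rcases le_total 1 (T * α) with h' | h'
  · have h1 : T⁻¹ ≤ α := by rw [inv_le_iff_one_le_mul₀ hT0]; linarith
    have hα0 : 0 < α := hTi.trans_le h1
    rw [kinkedForm_of_mem h h', clamp_of_mem (by gcongr) (by nlinarith),
      log_half_sq, ← Real.log_div (by positivity) (by positivity)]
    congr 1
    field_simp
    ring
  · have h1 : α ≤ T⁻¹ := by rw [← one_div, le_div_iff₀ hT0]; linarith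
    rw [kinkedForm_of_ge hT hα h', clamp_of_le (by gcongr),
      log_half_sq, ← Real.log_div (by positivity) (by positivity)]
    congr 1
    field_simp

lemma exp_half_sq (t : ℝ) : Real.exp (t / 2) ^ 2 = Real.exp t := by
  rw [← Real.exp_nat_mul]; push_cast; ring_nf

lemma weight_kinkedMetric {t : ℝ} (ht : 0 ≤ t) :
    weight (kinkedMetric t) = fun z => clampPotential 1 (Real.exp t) (‖z‖ ^ 2) := by
  ext z
  simp only [weight, kinkedMetric, Matrix.cons_val_zero, Matrix.cons_val_one, norm_one]
  rw [log_kinkedForm_one_left (one_le_exp_half ht) (norm_nonneg _), exp_half_sq]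

lemma weightAtInfinity_kinkedMetric {t : ℝ} (ht : 0 ≤ t) :
    weightAtInfinity (kinkedMetric t) =
      fun z => clampPotential ((Real.exp (t / 2))⁻¹ ^ 2) 1 (‖z‖ ^ 2) := by
  ext z
  simp only [weightAtInfinity, kinkedMetric, Matrix.cons_val_zero, Matrix.cons_val_one, norm_one]
  rw [log_kinkedForm_one_right (one_le_exp_half ht) (norm_nonneg _)]

lemma isCurvatureDensity_kinkedMetric {t : ℝ} (ht : 0 ≤ t) :
    IsCurvatureDensity (weight (kinkedMetric t)) (clampDensity 1 (Real.exp t)) := by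
  rw [weight_kinkedMetric ht]
  exact isCurvatureDensity_clampPotential one_pos (Real.one_le_exp ht)

lemma isH11_kinkedMetric {t : ℝ} (ht : 0 ≤ t) : IsH11 (kinkedMetric t) where
  homogeneous := kinkedMetric_smul t
  pos _ hv := kinkedMetric_pos ht hv
  continuous := continuous_kinkedMetric.comp (Continuous.prodMk continuous_const continuous_id)
  curvature := ⟨_, isCurvatureDensity_kinkedMetric ht⟩
  curvatureAtInfinity := by
    rw [weightAtInfinity_kinkedMetric ht]
    have h1 := inv_le_one_of_one_le₀ (one_le_exp_half ht)
    have h2 : 0 < (Real.exp (t / 2))⁻¹ := by positivity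
    exact ⟨_, isCurvatureDensity_clampPotential (by positivity) (by nlinarith)⟩

/-! ### The K-energy -/

open MeasureTheory in
lemma IsCurvatureDensity.locallyIntegrable {φ ρ : ℂ → ℝ} (h : IsCurvatureDensity φ ρ) :
    LocallyIntegrable ρ := by
  intro z
  obtain ⟨C, hC⟩ := h.locallyBounded (‖z‖ + 1)
  refine ⟨Metric.ball z 1, Metric.ball_mem_nhds z one_pos, ?_⟩
  refine Measure.integrableOn_of_bounded (M := C) measure_ball_lt_top.ne
    h.measurable.aestronglyMeasurable ?_
  filter_upwards [ae_restrict_mem measurableSet_ball] with w hw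
  rw [Real.norm_of_nonneg (h.nonneg w)]
  refine hC w ?_
  rw [mem_ball_iff_norm] at hw
  linarith [norm_le_norm_add_norm_sub' w z]

open MeasureTheory in
/-- The curvature density is unique almost everywhere. -/
lemma IsCurvatureDensity.ae_eq {φ ρ ρ' : ℂ → ℝ} (h : IsCurvatureDensity φ ρ)
    (h' : IsCurvatureDensity φ ρ') : ρ =ᵐ[volume] ρ' := by
  refine ae_eq_of_integral_contDiff_smul_eq h.locallyIntegrable h'.locallyIntegrable
    fun g hg hgc => ?_
  have := (h.integral_eq g hg hgc).symm.trans (h'.integral_eq g hg hgc)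
  simpa only [smul_eq_mul, mul_comm] using this

open MeasureTheory in
lemma curvatureDensity_kinkedMetric {t : ℝ} (ht : 0 ≤ t) :
    curvatureDensity (kinkedMetric t) =ᵐ[volume] clampDensity 1 (Real.exp t) := by
  have H : ∃ ρ, IsCurvatureDensity (weight (kinkedMetric t)) ρ :=
    ⟨_, isCurvatureDensity_kinkedMetric ht⟩
  rw [curvatureDensity, dif_pos H]
  exact H.choose_spec.ae_eq (isCurvatureDensity_kinkedMetric ht)

open MeasureTheory Set in
/-- Integration of radial functions on the plane. -/
lemma integral_norm_sq (f : ℝ → ℝ) : ∫ z : ℂ, f (‖z‖ ^ 2) = Real.pi * ∫ r in Ioi 0, f r := by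
  rw [integral_fun_norm_addHaar (volume : Measure ℂ) (fun x => f (x ^ 2)),
    ← integral_comp_rpow_Ioi_of_pos (g := f) (p := 2) two_pos]
  have h1 : (volume : Measure ℂ).real (Metric.ball 0 1) = Real.pi := by
    simp [Measure.real]
  rw [h1, Complex.finrank_real_complex, nsmul_eq_mul, smul_eq_mul]
  have h2 : ∀ x : ℝ, (2 * x ^ ((2 : ℝ) - 1)) • f (x ^ (2 : ℝ)) =
      2 * (x ^ (2 - 1) • f (x ^ 2)) := by
    intro x
    norm_num
    ring
  simp only [h2]
  rw [integral_const_mul]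
  push_cast
  ring

open MeasureTheory Set Filter Topology in
lemma integral_fsDensity : ∫ z, fsDensity z = 1 := by
  unfold fsDensity
  rw [integral_norm_sq (fun r => (Real.pi * (1 + r) ^ 2)⁻¹)]
  have hd : ∀ x ∈ Ici (0 : ℝ), HasDerivAt (fun r => -(Real.pi * (1 + r))⁻¹)
      (Real.pi * (1 + x) ^ 2)⁻¹ x := by
    intro x hx
    have hx' : 0 < 1 + x := by have : (0 : ℝ) ≤ x := hx; linarith
    have := ((((hasDerivAt_id x).const_add 1).const_mul Real.pi).inv
      (mul_pos Real.pi_pos hx').ne').neg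
    refine this.congr_deriv ?_
    simp only [id]
    have := Real.pi_pos
    field_simp
  have hlim : Tendsto (fun r : ℝ => -(Real.pi * (1 + r))⁻¹) atTop (𝓝 (-0)) :=
    ((tendsto_atTop_add_const_left _ 1 tendsto_id).const_mul_atTop
      Real.pi_pos).inv_tendsto_atTop.neg
  rw [integral_Ioi_of_hasDerivAt_of_nonneg' hd
    (fun x _ => by have := Real.pi_pos; positivity) hlim]
  have := Real.pi_pos
  simp

open MeasureTheory in
-- A non-integrable function would have integral `0` by convention.
lemma integrable_fsDensity : Integrable fsDensity :=
  integrable_of_integral_eq_one integral_fsDensity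

lemma fsDensity_pos (z : ℂ) : 0 < fsDensity z := by
  have := Real.pi_pos
  unfold fsDensity; positivity

lemma hasFDerivAt_log_fsDensity (z : ℂ) : HasFDerivAt (fun w => Real.log (fsDensity w))
    ((-4 * (1 + ‖z‖ ^ 2)⁻¹) • innerSL ℝ z) z := by
  have hn : HasFDerivAt (fun z : ℂ => ‖z‖ ^ 2) (2 • innerSL ℝ z) z :=
    (hasStrictFDerivAt_norm_sq z).hasFDerivAt
  have h := ((hn.const_add 1).log (by positivity)).const_mul (-2)
  have h' := h.const_add (-Real.log Real.pi)
  refine (h'.congr_of_eventuallyEq (.of_forall fun w => ?_)).congr_fderiv ?_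
  · have := Real.pi_pos
    simp only [fsDensity]
    rw [Real.log_inv, Real.log_mul this.ne' (by positivity), Real.log_pow]
    push_cast; ring
  · ext v
    simp
    ring

/-- Fubini–Study is Kähler–Einstein: `log fsDensity` is `-2 Φ₀` up to a constant. -/
lemma ricciDensity_eq (z : ℂ) : ricciDensity z = 2 * fsDensity z := by
  have h1 : fderiv ℝ (fun w => Real.log (fsDensity w)) =
      fun z => (-4 * (1 + ‖z‖ ^ 2)⁻¹) • innerSL ℝ z := by
    ext1 z; exact (hasFDerivAt_log_fsDensity z).fderiv
  have hn : HasFDerivAt (fun z : ℂ => ‖z‖ ^ 2) (2 • innerSL ℝ z) z :=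
    (hasStrictFDerivAt_norm_sq z).hasFDerivAt
  have hm : 1 + ‖z‖ ^ 2 ≠ 0 := by positivity
  have h2 := (((hasDerivAt_inv hm).comp_hasFDerivAt z (hn.const_add 1)).const_mul (-4)).smul
    (innerSL ℝ : ℂ →L[ℝ] ℂ →L[ℝ] ℝ).hasFDerivAt
  have h3 := h2.fderiv
  rw [ricciDensity, InnerProductSpace.laplacian_eq_iteratedFDeriv_complexPlane]
  simp only [iteratedFDeriv_two_apply, Matrix.cons_val_zero, Matrix.cons_val_one]
  rw [h1]
  erw [h3]
  have e : ‖z‖ ^ 2 = z.re * z.re + z.im * z.im := by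
    rw [← Complex.normSq_eq_norm_sq, Complex.normSq_apply]
  have i1 : innerSL ℝ z 1 = z.re := by simp [Complex.inner]
  have i2 : innerSL ℝ z Complex.I = z.im := by simp [Complex.inner]
  have i3 : innerSL ℝ (1 : ℂ) 1 = (1 : ℝ) := by simp
  have i4 : innerSL ℝ Complex.I Complex.I = (1 : ℝ) := by simp
  simp [fsDensity]
  erw [i1, i2, i3, i4]
  field_simp
  rw [e]
  ring

lemma meanCurvature_eq : meanCurvature = 2 := by
  simp only [meanCurvature, ricciDensity_eq]
  rw [MeasureTheory.integral_const_mul, integral_fsDensity]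
  norm_num

/-- The radial profile of `Φ - Φ₀` for the potential `Φ = clampPotential 1 E ‖z‖²`. -/
noncomputable def relativeProfile (E r : ℝ) : ℝ := clampPotential 1 E r - Real.log (1 + r)

lemma weight_fubiniStudy : weight fubiniStudy = fun z => Real.log (1 + ‖z‖ ^ 2) := by
  ext z
  simp [weight, fubiniStudy]

lemma weight_sub_weight {t : ℝ} (ht : 0 ≤ t) (z : ℂ) :
    weight (kinkedMetric t) z - weight fubiniStudy z =
      relativeProfile (Real.exp t) (‖z‖ ^ 2) := by
  rw [weight_kinkedMetric ht, weight_fubiniStudy, relativeProfile]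

lemma abs_relativeProfile_le {t : ℝ} (ht : 0 ≤ t) (z : ℂ) :
    |relativeProfile (Real.exp t) (‖z‖ ^ 2)| ≤ t / 2 := by
  rw [← weight_sub_weight ht]
  have hv : (![1, z] : Fin 2 → ℂ) ≠ 0 := fun h => by simpa using congrFun h 0
  have hp := kinkedMetric_pos ht hv
  have hf : 0 < fubiniStudy ![1, z] := by simp [fubiniStudy]; positivity
  have h1 := Real.log_le_log (by positivity) (le_kinkedMetric ht ![1, z])
  have h2 := Real.log_le_log hp (kinkedMetric_le ht ![1, z])
  rw [Real.log_mul (by positivity) hf.ne', Real.log_inv, Real.log_exp] at h1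
  rw [Real.log_mul (by positivity) hf.ne', Real.log_exp] at h2
  rw [weight, weight, abs_le]
  constructor <;> linarith

lemma clampDensity_le_fsDensity {E : ℝ} (hE : 1 ≤ E) (z : ℂ) :
    clampDensity 1 E z ≤ E * fsDensity z := by
  have h1 := le_clamp 1 E (‖z‖ ^ 2)
  have h2 : clamp 1 E (‖z‖ ^ 2) ≤ E := max_le hE (min_le_right _ _)
  have hπ := Real.pi_pos
  unfold clampDensity
  split_ifs
  · have := fsDensity_pos z; positivity
  · rw [fsDensity, ← div_eq_mul_inv]
    gcongr ?_ / (_ * ?_ ^ 2)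
    linarith

/-- Off the annulus the density is `exp (-2 Φ) / π` (Liouville's equation), just as `fsDensity` is
`exp (-2 Φ₀) / π`. On the annulus both sides vanish. -/
lemma log_clampDensity_div_mul {E : ℝ} (z : ℂ) :
    Real.log (clampDensity 1 E z / fsDensity z) * clampDensity 1 E z =
      -2 * (relativeProfile E (‖z‖ ^ 2) * clampDensity 1 E z) := by
  have hπ := Real.pi_pos
  have hc : 0 < clamp 1 E (‖z‖ ^ 2) := one_pos.trans_le (le_clamp 1 E (‖z‖ ^ 2))
  unfold clampDensity
  split_ifs
  · simp
  · have e : clamp 1 E (‖z‖ ^ 2) / (Real.pi * (‖z‖ ^ 2 + clamp 1 E (‖z‖ ^ 2)) ^ 2) / fsDensity z =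
        clamp 1 E (‖z‖ ^ 2) * (1 + ‖z‖ ^ 2) ^ 2 / (‖z‖ ^ 2 + clamp 1 E (‖z‖ ^ 2)) ^ 2 := by
      unfold fsDensity; field_simp
    rw [e, Real.log_div (by positivity) (by positivity), Real.log_mul hc.ne' (by positivity),
      Real.log_pow, Real.log_pow, relativeProfile, clampPotential]
    push_cast
    ring

open MeasureTheory in
-- With `f = Φ - Φ₀` the three terms are `∫ f (ω_Φ + ω₀)`, `-2 ∫ f ω₀` and `-2 ∫ f ω_Φ`.
lemma kEnergy_kinkedMetric {t : ℝ} (ht : 0 ≤ t) :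
    kEnergy (kinkedMetric t) = -∫ z : ℂ, relativeProfile (Real.exp t) (‖z‖ ^ 2) *
      (clampDensity 1 (Real.exp t) z + fsDensity z) := by
  have hE : 1 ≤ Real.exp t := Real.one_le_exp ht
  have hc := curvatureDensity_kinkedMetric ht
  have hcont : Continuous fun z : ℂ => relativeProfile (Real.exp t) (‖z‖ ^ 2) := by
    have h1 := (lipschitzWith_clampPotential one_pos hE).continuous
    have h2 : Continuous fun z : ℂ => Real.log (1 + ‖z‖ ^ 2) :=
      Continuous.log (by fun_prop) fun z => by positivity
    exact h1.sub h2
  have hb : ∀ᵐ z : ℂ, ‖relativeProfile (Real.exp t) (‖z‖ ^ 2)‖ ≤ t / 2 :=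
    .of_forall fun z => abs_relativeProfile_le ht z
  have Iρ : Integrable (clampDensity 1 (Real.exp t)) :=
    (integrable_fsDensity.const_mul (Real.exp t)).mono'
      (measurable_clampDensity _ _).aestronglyMeasurable (.of_forall fun z => by
        rw [Real.norm_of_nonneg (clampDensity_nonneg one_pos z)]
        exact clampDensity_le_fsDensity hE z)
  have J1 := Iρ.bdd_mul hcont.aestronglyMeasurable hb
  have J2 := integrable_fsDensity.bdd_mul hcont.aestronglyMeasurable hb
  have e1 : energy (kinkedMetric t) = ∫ z : ℂ, relativeProfile (Real.exp t) (‖z‖ ^ 2) *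
      (clampDensity 1 (Real.exp t) z + fsDensity z) := by
    refine integral_congr_ae ?_
    filter_upwards [hc] with z hz
    rw [weight_sub_weight ht, hz]
  have e2 : ricciEnergy (kinkedMetric t) =
      2 * ∫ z : ℂ, relativeProfile (Real.exp t) (‖z‖ ^ 2) * fsDensity z := by
    rw [← integral_const_mul]
    refine integral_congr_ae (.of_forall fun z => ?_)
    simp only [weight_sub_weight ht, ricciDensity_eq]
    ring
  have e3 : entropy (kinkedMetric t) =
      -2 * ∫ z : ℂ, relativeProfile (Real.exp t) (‖z‖ ^ 2) * clampDensity 1 (Real.exp t) z := by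
    rw [← integral_const_mul]
    refine integral_congr_ae ?_
    filter_upwards [hc] with z hz
    rw [hz, log_clampDensity_div_mul]
  rw [kEnergy, e1, e2, e3, meanCurvature_eq]
  simp only [mul_add]
  rw [integral_add J1 J2]
  ring

/-! ### Evaluation of the energy integral -/

lemma relativeProfile_of_le {E r : ℝ} (h : r ≤ 1) : relativeProfile E r = 0 := by
  rw [relativeProfile, clampPotential, clamp_of_le h]
  simp [add_comm]

lemma relativeProfile_of_mem {E r : ℝ} (h : 1 ≤ r) (h' : r ≤ E) :
    relativeProfile E r = Real.log 2 + 1 / 2 * Real.log r - Real.log (1 + r) := by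
  rw [relativeProfile, clampPotential, clamp_of_mem h h', ← two_mul,
    Real.log_mul two_ne_zero (by positivity)]
  ring

lemma relativeProfile_of_ge {t r : ℝ} (ht : 0 ≤ t) (h : Real.exp t ≤ r) :
    relativeProfile (Real.exp t) r =
      Real.log (Real.exp t + r) - Real.log (1 + r) - t / 2 := by
  rw [relativeProfile, clampPotential, clamp_of_ge (Real.one_le_exp ht) h, Real.log_exp, add_comm r]
  ring

/-- A primitive of `(log 2 + log r / 2 - log (1 + r)) / (1 + r)²`. -/
noncomputable def middlePrimitive (r : ℝ) : ℝ :=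
  -(Real.log 2 + 1 / 2 * Real.log r - Real.log (1 + r)) * (1 + r)⁻¹ +
    1 / 2 * Real.log r - 1 / 2 * Real.log (1 + r) + (1 + r)⁻¹

lemma hasDerivAt_middlePrimitive {r : ℝ} (hr : 0 < r) : HasDerivAt middlePrimitive
    ((Real.log 2 + 1 / 2 * Real.log r - Real.log (1 + r)) * ((1 + r) ^ 2)⁻¹) r := by
  have h1 : HasDerivAt Real.log r⁻¹ r := Real.hasDerivAt_log hr.ne'
  have h2 : HasDerivAt (fun r => 1 + r) 1 r := (hasDerivAt_id r).const_add 1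
  have hr1 : 1 + r ≠ 0 := by positivity
  have h3 := h2.log hr1
  have h4 := h2.fun_inv hr1
  have := (((((((h1.const_mul (1 / 2)).const_add (Real.log 2)).fun_sub h3).fun_neg.fun_mul
    h4).fun_add (h1.const_mul (1 / 2))).fun_sub (h3.const_mul (1 / 2))).fun_add h4)
  refine this.congr_deriv ?_
  field_simp
  ring

/-- A primitive of `(log (E + r) - log (1 + r) - t / 2) (1 / (1 + r)² + E / (E + r)²)`. -/
noncomputable def outerPrimitive (t E r : ℝ) : ℝ :=
  -(Real.log (E + r) - Real.log (1 + r) - t / 2) * ((1 + r)⁻¹ + E * (E + r)⁻¹) -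
    E * (E + r)⁻¹ + (1 + r)⁻¹ + (Real.log (E + r) - Real.log (1 + r))

lemma hasDerivAt_outerPrimitive (t : ℝ) {E r : ℝ} (hE : 0 < E) (hr : 0 < r) :
    HasDerivAt (outerPrimitive t E) ((Real.log (E + r) - Real.log (1 + r) - t / 2) *
      (((1 + r) ^ 2)⁻¹ + E * ((E + r) ^ 2)⁻¹)) r := by
  have h2 : HasDerivAt (fun r => 1 + r) 1 r := (hasDerivAt_id r).const_add 1
  have h2' : HasDerivAt (fun r => E + r) 1 r := (hasDerivAt_id r).const_add E
  have hr1 : 1 + r ≠ 0 := by positivity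
  have hr2 : E + r ≠ 0 := by positivity
  have h3 := h2.log hr1
  have h4 := h2.fun_inv hr1
  have h3' := h2'.log hr2
  have h4' := (h2'.fun_inv hr2).const_mul E
  have := (((((h3'.fun_sub h3).sub_const (t / 2)).fun_neg.fun_mul (h4.fun_add h4')).fun_sub
    h4').fun_add h4).fun_add (h3'.fun_sub h3)
  refine this.congr_deriv ?_
  field_simp
  ring

open Filter Topology in
lemma tendsto_outerPrimitive (t : ℝ) {E : ℝ} (hE : 1 ≤ E) :
    Tendsto (outerPrimitive t E) atTop (𝓝 0) := by
  have h1 : ∀ c : ℝ, Tendsto (fun r : ℝ => (c + r)⁻¹) atTop (𝓝 0) := fun c =>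
    (tendsto_atTop_add_const_left _ c tendsto_id).inv_tendsto_atTop
  have h2 : Tendsto (fun r : ℝ => Real.log (E + r) - Real.log (1 + r)) atTop (𝓝 0) := by
    have h3 : Tendsto (fun r : ℝ => Real.log (1 + (E - 1) * (1 + r)⁻¹)) atTop
        (𝓝 (Real.log (1 + (E - 1) * 0))) :=
      (tendsto_const_nhds.add ((h1 1).const_mul _)).log (by norm_num)
    rw [mul_zero, add_zero, Real.log_one] at h3
    refine h3.congr' ?_
    filter_upwards [eventually_ge_atTop 0] with r hr
    rw [← Real.log_div (by positivity) (by positivity)]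
    congr 1
    field_simp
    ring
  have := (((((h2.sub_const (t / 2)).neg.mul ((h1 1).add ((h1 E).const_mul E))).sub
    ((h1 E).const_mul E)).add (h1 1)).add h2)
  unfold outerPrimitive
  simpa using this

open MeasureTheory Set in
/-- The integral of `Φ - Φ₀` against `ω_Φ + ω₀` in the variable `r = |z|²`. -/
lemma integral_relativeProfile {t : ℝ} (ht : 0 ≤ t) {W : ℝ → ℝ}
    (hW1 : ∀ r, 1 < r → r < Real.exp t → W r = ((1 + r) ^ 2)⁻¹)
    (hW2 : ∀ r, Real.exp t < r →
      W r = ((1 + r) ^ 2)⁻¹ + Real.exp t * ((Real.exp t + r) ^ 2)⁻¹) :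
    ∫ r in Ioi 0, relativeProfile (Real.exp t) r * W r = -t / 4 := by
  have hE : 1 ≤ Real.exp t := Real.one_le_exp ht
  set E := Real.exp t with hE_def
  have hE0 : 0 < E := by positivity
  have c1 : EqOn (fun r => relativeProfile E r * W r)
      (fun r => (Real.log 2 + 1 / 2 * Real.log r - Real.log (1 + r)) * ((1 + r) ^ 2)⁻¹)
      (Ioo 1 E) := fun r hr => by
    simp only [relativeProfile_of_mem hr.1.le hr.2.le, hW1 r hr.1 hr.2]
  have c2 : EqOn (fun r => relativeProfile E r * W r)
      (fun r => (Real.log (E + r) - Real.log (1 + r) - t / 2) *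
        (((1 + r) ^ 2)⁻¹ + E * ((E + r) ^ 2)⁻¹)) (Ioi E) := fun r hr => by
    simp only [hE_def, relativeProfile_of_ge ht (le_of_lt hr), hW2 r hr]
  have hcont : ContinuousOn (fun r : ℝ =>
      (Real.log 2 + 1 / 2 * Real.log r - Real.log (1 + r)) * ((1 + r) ^ 2)⁻¹) (uIcc 1 E) := by
    rw [uIcc_of_le hE]
    intro r hr
    have h1 : r ≠ 0 := by have := hr.1; positivity
    have h2 : 1 + r ≠ 0 := by have := hr.1; positivity
    exact ContinuousAt.continuousWithinAt (by fun_prop (disch := first | assumption | positivity))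
  have hII := hcont.intervalIntegrable (μ := volume)
  have v1 : ∫ r in Ioo 1 E, relativeProfile E r * W r = middlePrimitive E - middlePrimitive 1 := by
    rw [setIntegral_congr_fun measurableSet_Ioo c1, ← integral_Ioc_eq_integral_Ioo,
      ← intervalIntegral.integral_of_le hE]
    refine intervalIntegral.integral_eq_sub_of_hasDerivAt (fun r hr => ?_) hII
    rw [uIcc_of_le hE] at hr
    exact hasDerivAt_middlePrimitive (by linarith [hr.1])
  have hd : ∀ r ∈ Ici E, HasDerivAt (outerPrimitive t E)
      ((Real.log (E + r) - Real.log (1 + r) - t / 2) *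
        (((1 + r) ^ 2)⁻¹ + E * ((E + r) ^ 2)⁻¹)) r :=
    fun r hr => hasDerivAt_outerPrimitive t hE0 (hE0.trans_le hr)
  -- The constant sign gives integrability up to infinity from the limit of the primitive.
  have hneg : ∀ r ∈ Ioi E, (Real.log (E + r) - Real.log (1 + r) - t / 2) *
        (((1 + r) ^ 2)⁻¹ + E * ((E + r) ^ 2)⁻¹) ≤ 0 := by
    intro r hr
    have hr' : E < r := hr
    have hr0 : 0 < r := hE0.trans hr
    refine mul_nonpos_of_nonpos_of_nonneg ?_ (by positivity)
    -- With `T = exp (t / 2)` this says `(T - 1)(r - T) ≥ 0`.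
    have hle : E + r ≤ Real.exp (t / 2) * (1 + r) := by
      have h1 := one_le_exp_half ht
      have h2 : E = Real.exp (t / 2) ^ 2 := (exp_half_sq t).symm
      rw [h2] at hr' ⊢
      have h3 : Real.exp (t / 2) ≤ r := by nlinarith
      nlinarith [mul_nonneg (sub_nonneg.2 h1) (sub_nonneg.2 h3)]
    have := Real.log_le_log (by positivity) hle
    rw [Real.log_mul (by positivity) (by positivity), Real.log_exp] at this
    linarith
  have hlim := tendsto_outerPrimitive t hE
  have v2 : ∫ r in Ioi E, relativeProfile E r * W r = 0 - outerPrimitive t E E := by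
    rw [setIntegral_congr_fun measurableSet_Ioi c2]
    exact integral_Ioi_of_hasDerivAt_of_nonpos' hd hneg hlim
  have i2 : IntegrableOn (fun r => relativeProfile E r * W r) (Ioi E) :=
    (integrableOn_congr_fun c2 measurableSet_Ioi).2
      (integrableOn_Ioi_deriv_of_nonpos' hd hneg hlim)
  have i1 : IntegrableOn (fun r => relativeProfile E r * W r) (Ioc 1 E) := by
    rw [integrableOn_Ioc_iff_integrableOn_Ioo, integrableOn_congr_fun c1 measurableSet_Ioo,
      ← integrableOn_Ioc_iff_integrableOn_Ioo, ← intervalIntegrable_iff_integrableOn_Ioc_of_le hE]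
    exact hII
  have hsub : ∫ r in Ioi 0, relativeProfile E r * W r = ∫ r in Ioi 1, relativeProfile E r * W r :=
    setIntegral_eq_of_subset_of_forall_sdiff_eq_zero measurableSet_Ioi
      (Ioi_subset_Ioi zero_le_one) fun r hr => by
        rw [relativeProfile_of_le (not_lt.1 hr.2), zero_mul]
  rw [hsub, ← Ioc_union_Ioi_eq_Ioi hE, setIntegral_union (Ioc_disjoint_Ioi le_rfl)
    measurableSet_Ioi i1 i2, integral_Ioc_eq_integral_Ioo, v1, v2]
  have hl : Real.log E = t := Real.log_exp t
  unfold middlePrimitive outerPrimitive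
  rw [← two_mul E, Real.log_mul two_ne_zero hE0.ne', hl, Real.log_one,
    show (1 : ℝ) + 1 = 2 by norm_num]
  have h1 : 1 + E ≠ 0 := by positivity
  field_simp
  ring

lemma kEnergyAffineAlong_kinkedMetric : KEnergyAffineAlong kinkedMetric := by
  refine ⟨0, 1 / 4, fun t ht => ?_⟩
  have hπ := Real.pi_pos
  have hE : 1 ≤ Real.exp t := Real.one_le_exp ht.1
  classical
  -- `W` is `π` times the density of `ω_Φ + ω₀` as a function of `r = |z|²`; this `π` and the one
  -- from polar integration cancel.
  set W : ℝ → ℝ := fun r => (if 1 < r ∧ r < Real.exp t then 0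
    else clamp 1 (Real.exp t) r / (r + clamp 1 (Real.exp t) r) ^ 2) + ((1 + r) ^ 2)⁻¹ with hW
  have e : ∀ z : ℂ, relativeProfile (Real.exp t) (‖z‖ ^ 2) *
      (clampDensity 1 (Real.exp t) z + fsDensity z) =
      Real.pi⁻¹ * (relativeProfile (Real.exp t) (‖z‖ ^ 2) * W (‖z‖ ^ 2)) := by
    intro z
    simp only [hW, clampDensity, fsDensity]
    have hc : 0 < clamp 1 (Real.exp t) (‖z‖ ^ 2) := one_pos.trans_le (le_clamp _ _ _)
    split_ifs
    · field_simp
      ring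
    · field_simp
  rw [kEnergy_kinkedMetric ht.1]
  simp only [e]
  rw [MeasureTheory.integral_const_mul,
    integral_norm_sq (fun r => relativeProfile (Real.exp t) r * W r),
    integral_relativeProfile ht.1]
  · field_simp
    ring
  · intro r h1 h2
    simp only [hW]
    rw [if_pos ⟨h1, h2⟩, zero_add]
  · intro r h1
    simp only [hW]
    rw [if_neg (fun h => lt_asymm h.2 h1), clamp_of_ge hE h1.le, add_comm r, div_eq_mul_inv,
      add_comm]

lemma isGeodesicInH11_kinkedMetric : IsGeodesicInH11 kinkedMetric :=
  ⟨fun _ ht => isH11_kinkedMetric ht.1, isGeodesic_kinkedMetric⟩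

end KEnergy

theorem theorem1p1 :
    (∃ Φ : ℝ → KEnergy.SqNorm,
      KEnergy.IsGeodesicInH11 Φ ∧
      (∀ t ∈ Set.Icc (0 : ℝ) 1, KEnergy.IsS1Invariant (Φ t)) ∧
      KEnergy.KEnergyAffineAlong Φ ∧
      ¬ KEnergy.IsOneParameterOrbit Φ ∧
      Φ 0 = KEnergy.fubiniStudy ∧
      ∀ t ∈ Set.Icc (0 : ℝ) 1, ∀ y : ℝ,
        KEnergy.legendre (KEnergy.logWeight (Φ t)) y =
          if y ∈ Set.Icc (0 : ℝ) 1 then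
            ((KEnergy.symbolFS y + t * KEnergy.kink y : ℝ) : EReal)
          else ⊤) ∧
    ¬ KEnergy.StrictlyConvexModAutomorphisms :=
  ⟨⟨KEnergy.kinkedMetric, KEnergy.isGeodesicInH11_kinkedMetric,
    fun t _ => KEnergy.isS1Invariant_kinkedMetric t, KEnergy.kEnergyAffineAlong_kinkedMetric,
    KEnergy.not_isOneParameterOrbit_kinkedMetric, KEnergy.kinkedMetric_zero,
    fun _ ht y => KEnergy.legendre_logWeight_kinkedMetric ht.1 y⟩,
    fun h => KEnergy.not_isOneParameterOrbit_kinkedMetric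
      (h _ KEnergy.isGeodesicInH11_kinkedMetric KEnergy.kEnergyAffineAlong_kinkedMetric)⟩
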